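/- Let $N\ge 1$, $m>0$, $p>1$, $K_1,K_2>0$, put $m^-:=\min(1,m)$ and $\lambda:=m(p-1)$, and assume $\lambda<1$. Then there is a constant $\gamma>0$, depending only on $N,m,p,K_1,K_2$, such that the following holds. Let $\Omega\subset\mathbb R^N$ be open, $T>0$, $\Omega_T:=\Omega\times(0,T)$, and let $\mathbf A=\mathbf A(x,t,u,\xi):\Omega_T\times(0,\infty)\times\mathbb R^N\to\mathbb R^N$ be a Carathéodory function (Lebesgue measurable in $(x,t)$ for all $(u,\xi)$, continuous in $(u,\xi)$ for a.e. $(x,t)$) satisfying, for a.e. $(x,t)$ and all values $u>0$ and $Du=\xi\in\mathbb R^N$, with $Du^{m^-}:=m^-u^{m^--1}Du$, $$\mathbf A(x,t,u,Du)\cdot Du^{m^-}\ge K_1u^{(m-m^-)(p-1)}|Du^{m^-}|^p,\qquad |\mathbf A(x,t,u,Du)|\le K_2u^{(m-m^-)(p-1)}|Du^{m^-}|^{p-1}.$$ Let $u$ be a nonnegative, locally bounded, local weak solution of $u_t-\operatorname{div}\mathbf A(x,t,u,Du)=0$ in $\Omega_T$, that is, $0\le u\in C_{\rm loc}(0,T;L^{1+m^-}_{\rm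 loc}(\Omega))\cap L^\infty_{\rm loc}(\Omega_T)$, $u^{m^-}\in L^p_{\rm loc}(0,T;W^{1,p}_{\rm loc}(\Omega))$, and for every compact $E\subset\Omega$, all $0<t_1<t_2<T$ and all $0\le\zeta\in W^{1,1+1/m^-}(0,T;L^{1+1/m^-}(E))\cap L^p(0,T;W^{1,p}_0(E))$, $$\int_E u\zeta\,dx\Big|_{t_1}^{t_2}+\int_{t_1}^{t_2}\!\!\int_E\{-u\zeta_\tau+\mathbf A(x,\tau,u,Du)\cdot D\zeta\}\,dx\,d\tau=0 ,$$ where $W_0^{1,p}(E)$ is the closure in $W^{1,p}$ of the smooth functions with compact support in the interior of $E$, $Du:=\frac1{m^-}u^{1-m^-}Du^{m^-}$, and $\mathbf A(x,\tau,u,Du):=0$ where $u=0$. Then for all $y\in\mathbb R^N$, $r>0$ and $s<t$ with $B_{2r}(y)\times(s,t)\subset\Omega_T$, $$\sup_{\tau}\frac1{|B_r(y)|}\int_{B_r(y)}u(x,\tau)\,dx\le\gamma\inf_{\tau}\frac1{|B_{2r}(y)|}\int_{B_{2r}(y)}u(x,\tau)\,dx+\gamma\Big(\frac{t-s}{r^p}\Big)^{\frac1{1-\lambda}},$$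 where the supremum and the infimum are over all $\tau\in[s,t]\cap(0,T)$ (so over all of $[s,t]$ if $0<s<t<T$), and the integrals are taken in $[0,\infty]$. -/

import Mathlib

open MeasureTheory Set Filter Topology Metric
open scoped ENNReal ContDiff

noncomputable section

namespace DoublyNonlinear

/-- `ℝ^N` with the Euclidean norm. -/
abbrev Space (N : ℕ) := EuclideanSpace ℝ (Fin N)

/-- `m⁻ = min (1, m)`. -/
def mMinus (m : ℝ) : ℝ := min 1 m

/-- The space-time domain `Ω_T = Ω × (0, T)`. -/
def spaceTime {N : ℕ} (Ω : Set (Space N)) (T : ℝ) : Set (Space N × ℝ) := Ω ×ˢ Ioo 0 T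

/-- The backward parabolic cylinder `Q_{r,η}(x₀,t₀) = B_r(x₀) × (t₀ - η, t₀)`. -/
def cylinder {N : ℕ} (r η : ℝ) (x₀ : Space N) (t₀ : ℝ) : Set (Space N × ℝ) :=
  ball x₀ r ×ˢ Ioo (t₀ - η) t₀

/-- The Carathéodory conditions on `A : Ω_T × ℝ₊ × ℝ^N → ℝ^N`, with `ℝ₊ = (0, ∞)`: measurable in
`(x, t)` for all `(v, ξ)`, and continuous in `(v, ξ)` for almost all `(x, t)`.
(`AEMeasurable` for the restricted Lebesgue measure is Lebesgue measurability on `Ω_T`.) -/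
structure IsCaratheodory {N : ℕ} (Ω : Set (Space N)) (T : ℝ)
    (A : Space N → ℝ → ℝ → Space N → Space N) : Prop where
  measurable : ∀ v : ℝ, 0 < v → ∀ ξ : Space N,
    AEMeasurable (fun z : Space N × ℝ => A z.1 z.2 v ξ) (volume.restrict (spaceTime Ω T))
  continuous : ∀ᵐ z : Space N × ℝ ∂(volume.restrict (spaceTime Ω T)),
    ContinuousOn (fun w : ℝ × Space N => A z.1 z.2 w.1 w.2) (Ioi 0 ×ˢ univ)

/-- The value of `D u^{m⁻} = m⁻ u^{m⁻ - 1} D u` at a point where `u = v > 0` and `D u = ξ`. -/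
def gradPow {N : ℕ} (m v : ℝ) (ξ : Space N) : Space N :=
  (mMinus m * v ^ (mMinus m - 1)) • ξ

/-- The structure conditions
`A(x,t,u,Du) · D u^{m⁻} ≥ K₁ u^{(m-m⁻)(p-1)} |D u^{m⁻}|^p` and
`|A(x,t,u,Du)| ≤ K₂ u^{(m-m⁻)(p-1)} |D u^{m⁻}|^{p-1}`, required for all values `v > 0` of `u` and
all values `ξ` of `D u`. -/
structure StructureConditions {N : ℕ} (Ω : Set (Space N)) (T m p K₁ K₂ : ℝ)
    (A : Space N → ℝ → ℝ → Space N → Space N) : Prop where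
  coercive : ∀ᵐ z : Space N × ℝ ∂(volume.restrict (spaceTime Ω T)),
    ∀ v : ℝ, 0 < v → ∀ ξ : Space N,
      K₁ * v ^ ((m - mMinus m) * (p - 1)) * ‖gradPow m v ξ‖ ^ p
        ≤ inner ℝ (A z.1 z.2 v ξ) (gradPow m v ξ)
  growth : ∀ᵐ z : Space N × ℝ ∂(volume.restrict (spaceTime Ω T)),
    ∀ v : ℝ, 0 < v → ∀ ξ : Space N,
      ‖A z.1 z.2 v ξ‖ ≤ K₂ * v ^ ((m - mMinus m) * (p - 1)) * ‖gradPow m v ξ‖ ^ (p - 1)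

/-- `g` is the weak gradient of `f` in the open set `Ω`. -/
structure IsWeakGradient {N : ℕ} (Ω : Set (Space N)) (f : Space N → ℝ)
    (g : Space N → Space N) : Prop where
  locallyIntegrable : LocallyIntegrableOn f Ω volume
  locallyIntegrable_grad : LocallyIntegrableOn g Ω volume
  integral_eq : ∀ φ : Space N → ℝ, ContDiff ℝ ∞ φ → HasCompactSupport φ → tsupport φ ⊆ Ω →
    ∀ e : Space N,
      ∫ x in Ω, f x * fderiv ℝ φ x e = - ∫ x in Ω, φ x * inner ℝ (g x) e

/-- `f ∈ W₀^{1,p}(E)` with weak gradient `g`: the pair `(f, g)` is a limit in `L^p(E)` of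
`(φ, ∇φ)` with smooth `φ` compactly supported in the interior of `E`. -/
def MemW0 {N : ℕ} (E : Set (Space N)) (p : ℝ) (f : Space N → ℝ) (g : Space N → Space N) : Prop :=
  ∃ φ : ℕ → Space N → ℝ,
    (∀ n, ContDiff ℝ ∞ (φ n) ∧ HasCompactSupport (φ n) ∧ tsupport (φ n) ⊆ interior E) ∧
    Tendsto (fun n => eLpNorm (fun x => φ n x - f x) (ENNReal.ofReal p) (volume.restrict E))
      atTop (𝓝 0) ∧
    Tendsto (fun n => eLpNorm (fun x => gradient (φ n) x - g x) (ENNReal.ofReal p)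
      (volume.restrict E)) atTop (𝓝 0)

/-- The nonnegative testing functions
`0 ≤ ζ ∈ W^{1,1+1/m⁻}(0,T; L^{1+1/m⁻}(E)) ∩ L^p(0,T; W₀^{1,p}(E))`, where `ζt` is the time
derivative and `Dζ` the spatial gradient of `ζ`. As a member of the first space, `ζ` is taken in
its absolutely continuous representative, so that `ζ(·,t)` is determined for every `t ∈ [0,T]`. -/
structure IsTestFunction {N : ℕ} (E : Set (Space N)) (T m p : ℝ)
    (ζ ζt : Space N → ℝ → ℝ) (Dζ : Space N → ℝ → Space N) : Prop where
  nonneg : ∀ x t, 0 ≤ ζ x t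
  memLp_time : MemLp (fun z : Space N × ℝ => ζ z.1 z.2) (ENNReal.ofReal (1 + 1 / mMinus m))
    (volume.restrict (E ×ˢ Ioo 0 T))
  memLp_timeDeriv : MemLp (fun z : Space N × ℝ => ζt z.1 z.2) (ENNReal.ofReal (1 + 1 / mMinus m))
    (volume.restrict (E ×ˢ Ioo 0 T))
  timeDeriv : ∀ t₁ t₂ : ℝ, 0 ≤ t₁ → t₁ ≤ t₂ → t₂ ≤ T →
    ∀ᵐ x ∂(volume.restrict E), ζ x t₂ - ζ x t₁ = ∫ τ in t₁..t₂, ζt x τ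
  memLp_space : MemLp (fun z : Space N × ℝ => ζ z.1 z.2) (ENNReal.ofReal p)
    (volume.restrict (E ×ˢ Ioo 0 T))
  memLp_grad : MemLp (fun z : Space N × ℝ => Dζ z.1 z.2) (ENNReal.ofReal p)
    (volume.restrict (E ×ˢ Ioo 0 T))
  memW0 : ∀ᵐ t ∂(volume.restrict (Ioo 0 T)), MemW0 E p (fun x => ζ x t) (fun x => Dζ x t)

/-- The flux `A(x, t, u, D u)` in terms of `v = u(x,t)` and of the value `w` of `D u^{m⁻}`:
there `D u = (1/m⁻) u^{1-m⁻} D u^{m⁻}`. Where `u = 0` one has `D u^{m⁻} = 0` almost everywhere,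
and the growth condition makes the flux vanish. -/
def flux {N : ℕ} (A : Space N → ℝ → ℝ → Space N → Space N) (m : ℝ) (x : Space N) (t v : ℝ)
    (w : Space N) : Space N :=
  if 0 < v then A x t v ((1 / mMinus m * v ^ (1 - mMinus m)) • w) else 0

/-- `u` is a nonnegative, locally bounded, local weak solution of `u_t - div A(x,t,u,Du) = 0` in
`Ω_T`, and `G` is the weak spatial gradient `D u^{m⁻}`.

All integrals in `weak_eq` converge: `u(·,t)` and `u` are in `L^{1+m⁻}`, whose dual exponent is
`1 + 1/m⁻`, and by the growth condition and local boundedness the flux is in `L^{p/(p-1)}`. -/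
structure IsLocalWeakSolutionWith {N : ℕ} (Ω : Set (Space N)) (T m p : ℝ)
    (A : Space N → ℝ → ℝ → Space N → Space N) (u : Space N → ℝ → ℝ)
    (G : Space N → ℝ → Space N) : Prop where
  nonneg : ∀ x ∈ Ω, ∀ t ∈ Ioo 0 T, 0 ≤ u x t
  /-- `u ∈ C_loc(0,T; L_loc^{1+m⁻}(Ω))` -/
  memLp_slice : ∀ K : Set (Space N), IsCompact K → K ⊆ Ω → ∀ t ∈ Ioo 0 T,
    MemLp (fun x => u x t) (ENNReal.ofReal (1 + mMinus m)) (volume.restrict K)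
  continuous_time : ∀ K : Set (Space N), IsCompact K → K ⊆ Ω → ∀ t₀ ∈ Ioo 0 T,
    Tendsto (fun t => eLpNorm (fun x => u x t - u x t₀) (ENNReal.ofReal (1 + mMinus m))
      (volume.restrict K)) (𝓝 t₀) (𝓝 0)
  /-- `u ∈ L^∞_loc(Ω_T)` -/
  locally_bounded : ∀ K : Set (Space N × ℝ), IsCompact K → K ⊆ spaceTime Ω T →
    MemLp (fun z : Space N × ℝ => u z.1 z.2) ∞ (volume.restrict K)
  /-- `u^{m⁻} ∈ L_loc^p(0,T; W_loc^{1,p}(Ω))` -/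
  memLp_pow : ∀ K : Set (Space N × ℝ), IsCompact K → K ⊆ spaceTime Ω T →
    MemLp (fun z : Space N × ℝ => u z.1 z.2 ^ mMinus m) (ENNReal.ofReal p) (volume.restrict K)
  memLp_grad : ∀ K : Set (Space N × ℝ), IsCompact K → K ⊆ spaceTime Ω T →
    MemLp (fun z : Space N × ℝ => G z.1 z.2) (ENNReal.ofReal p) (volume.restrict K)
  weakGradient : ∀ᵐ t ∂(volume.restrict (Ioo 0 T)),
    IsWeakGradient Ω (fun x => u x t ^ mMinus m) (fun x => G x t)
  /-- the integral identity -/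
  weak_eq : ∀ E : Set (Space N), IsCompact E → E ⊆ Ω →
    ∀ t₁ t₂ : ℝ, 0 < t₁ → t₁ < t₂ → t₂ < T →
    ∀ (ζ ζt : Space N → ℝ → ℝ) (Dζ : Space N → ℝ → Space N), IsTestFunction E T m p ζ ζt Dζ →
      (∫ x in E, u x t₂ * ζ x t₂) - (∫ x in E, u x t₁ * ζ x t₁)
        + ∫ z in E ×ˢ Ioo t₁ t₂,
            (-(u z.1 z.2 * ζt z.1 z.2)
              + inner ℝ (flux A m z.1 z.2 (u z.1 z.2) (G z.1 z.2)) (Dζ z.1 z.2)) = 0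

/-- `u` is a nonnegative, locally bounded, local weak solution of `u_t - div A(x,t,u,Du) = 0` in
`Ω_T` (the weak gradient of `u^{m⁻}` is unique up to null sets). -/
def IsLocalWeakSolution {N : ℕ} (Ω : Set (Space N)) (T m p : ℝ)
    (A : Space N → ℝ → ℝ → Space N → Space N) (u : Space N → ℝ → ℝ) : Prop :=
  ∃ G : Space N → ℝ → Space N, IsLocalWeakSolutionWith Ω T m p A u G

/-- The average of the nonnegative function `f` over the ball `B_r(y)`, with values in `[0,∞]`. -/
def ballAverage {N : ℕ} (y : Space N) (r : ℝ) (f : Space N → ℝ) : ℝ≥0∞ :=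
  (∫⁻ x in ball y r, ENNReal.ofReal (f x)) / volume (ball y r)

end DoublyNonlinear

end

/-! Write `μ = m⁻` and `λ = m(p-1)`. Testing the equation with a cutoff `η` bounds the change of the
mass `∫ u η` between two times by `∫∫ |A| |Dη|`. This flux integral must be controlled by masses
alone, although the growth condition involves `|Du^μ|^{p-1}`.

The gradient is paid for by a second test function, `η (u^μ + ν^μ)^{-b}` with small `b > 0`. It
decreases in `u`, so the coercive term has a favourable sign, while the time term is a primitive
growing only like `u^{1-bμ}`. Let `X` be the largest value of `∫ u η` on the time interval, `V =
|B_{2r}|` and `M = X/V + ν`. If `(t₂ - t₁)/r^p ≤ ν^{1-λ}`, the weighted energy is at most a constant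
times `V M^{1-bμ}` (`integral_energyDensity_le`). Young's inequality with weight `θ₀ M^{bμ}` then
splits the flux integral into this energy and a moment of `u` of order `c = λ + bμ(p-1)`. Since `λ <
1`, small `b` gives `c < 1`, so the moment is controlled by the mass (`density_le`,
`rpow_le_rpow_add_mul`). All powers of `M` combine to `V M`; unless `M` is already comparable to
`ν`, the flux integral is at most `V M / 2`. Hence `X` is at most the mass at any other time plus
`(X + Vν)/2`, and the `X` on the right is absorbed (`exists_integral_le`). The choice `ν =
((t-s)/r^p)^{1/(1-λ)}` gives the theorem.

The technical obstacle is that `u` has no time derivative, so a function of `u` is not an admissible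
test function. For almost every `t` the function `η (u(·,t)^μ + ν^μ)^{-b}`, frozen at time `t`, is
admissible on `(t-h, t)`; concavity of the primitive turns the increment of `u` into an increment of
the primitive (`sub_mul_profile_le`). Integrating in `t` and letting `h → 0`, with continuity of
translations in `L^{p/(p-1)}`, restores the unfrozen test function
(`neg_integral_inner_le_of_backward`). Local boundedness of `u` only serves qualitative
integrability and never enters the constants. -/

noncomputable section
namespace DoublyNonlinear

variable {N : ℕ}

/-! ### Elementary inequalities -/

/-- Young's inequality with a transparent constant: the first term on the right dominates when `C y
≤ θ x`, the second otherwise. The explicit power `θ^{1-p}` is needed later, when `θ` is chosen as a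
power of `M`. -/
lemma mul_rpow_sub_one_mul_le {p C θ x y : ℝ} (hp : 1 < p) (hC : 0 ≤ C) (hθ : 0 < θ)
    (hx : 0 ≤ x) (hy : 0 ≤ y) :
    C * x ^ (p - 1) * y ≤ θ * x ^ p + C ^ p * θ ^ (1 - p) * y ^ p := by
  have key : ∀ z : ℝ, 0 ≤ z → z ^ (p - 1) * z = z ^ p := fun z hz => by
    rw [← Real.rpow_add_one' hz (by linarith)]; ring_nf
  have h1 : 0 ≤ C ^ p * θ ^ (1 - p) * y ^ p := by positivity
  have h2 : 0 ≤ θ * x ^ p := by positivity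
  by_cases h : C * y ≤ θ * x
  · have : x ^ (p - 1) * (C * y) ≤ x ^ (p - 1) * (θ * x) := by gcongr
    calc C * x ^ (p - 1) * y = x ^ (p - 1) * (C * y) := by ring
      _ ≤ x ^ (p - 1) * (θ * x) := this
      _ = θ * (x ^ (p - 1) * x) := by ring
      _ = θ * x ^ p := by rw [key x hx]
      _ ≤ _ := by linarith
  · push Not at h
    have hx' : x ≤ C * y / θ := by rw [le_div_iff₀ hθ]; linarith
    have h0 : 0 ≤ C * y := by positivity
    calc C * x ^ (p - 1) * y = x ^ (p - 1) * (C * y) := by ring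
      _ ≤ (C * y / θ) ^ (p - 1) * (C * y) := by
          gcongr
      _ = ((C * y) ^ (p - 1) * (C * y)) * (θ ^ (p - 1))⁻¹ := by
          rw [Real.div_rpow h0 hθ.le]; ring
      _ = C ^ p * θ ^ (1 - p) * y ^ p := by
          rw [key _ h0, Real.mul_rpow hC hy, ← Real.rpow_neg hθ.le]; ring_nf
      _ ≤ _ := by linarith

/-- Linearises a sublinear power at the scale `M`. Integrating the right side requires only the mass
of `x`, and both terms become `M^c` when the mean of `x` is at most `M`. -/
lemma rpow_le_rpow_add_mul {x M c : ℝ} (hx : 0 ≤ x) (hM : 0 < M) (hc : 0 ≤ c) (hc1 : c ≤ 1) :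
    x ^ c ≤ M ^ c + M ^ (c - 1) * x := by
  have h1 : 0 ≤ M ^ (c - 1) * x := by positivity
  have h2 : 0 ≤ M ^ c := by positivity
  rcases le_or_gt x M with h | h
  · have : x ^ c ≤ M ^ c := by gcongr
    linarith
  · have hx0 : 0 < x := hM.trans h
    have : x ^ (c - 1) ≤ M ^ (c - 1) := Real.rpow_le_rpow_of_nonpos hM h.le (by linarith)
    calc x ^ c = x ^ (c - 1) * x := by rw [← Real.rpow_add_one hx0.ne']; ring_nf
      _ ≤ M ^ (c - 1) * x := by gcongr
      _ ≤ _ := by linarith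

/-- A weighted Young inequality for the degenerate gradient densities `κ |D w|^{p-1} (w + ν^μ)^e`,
where `w = u ^ μ`. -/
lemma density_le {p C θ x u ν μ d b e q c κ η δ r M : ℝ} (hp : 1 < p) (hC : 0 ≤ C) (hθ : 0 < θ)
    (hx : 0 ≤ x) (hu : 0 ≤ u) (hν : 0 < ν) (hμ : 0 < μ) (hκ : 0 ≤ κ)
    (hκd : κ ≤ (u + ν) ^ d) (hη : 0 ≤ η) (hη1 : η ≤ 1) (hδ : δ < 1) (hr : 0 < r) (hM : 0 < M)
    (hq : q = p * (e + b + 1) - b - 1) (hq0 : 0 ≤ q) (hc : c = d + μ * q) (hc0 : 0 ≤ c)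
    (hcδ : c ≤ 1 - δ * p) (hc1 : c ≤ 1) :
    C * (κ * x ^ (p - 1)) * (u ^ μ + ν ^ μ) ^ e * (η ^ (1 - δ) / r) ≤
      θ * (η * (κ * x ^ p) * (u ^ μ + ν ^ μ) ^ (-b - 1)) +
        C ^ p * θ ^ (1 - p) * 2 ^ q * (1 / r ^ p) * (M ^ c + M ^ (c - 1) * ((u + ν) * η)) := by
  set W := u ^ μ + ν ^ μ with hW
  have hW0 : 0 < W := by positivity
  have hv : 0 < u + ν := by positivity
  have hR : 0 ≤ C ^ p * θ ^ (1 - p) * 2 ^ q * (1 / r ^ p) *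
      (M ^ c + M ^ (c - 1) * ((u + ν) * η)) := by positivity
  rcases hη.eq_or_lt with h0 | h0
  · rw [← h0, Real.zero_rpow (by linarith)]
    rw [← h0] at hR
    simp only [zero_div, mul_zero, zero_mul, zero_add] at hR ⊢
    exact hR
  have hWle : W ≤ 2 * (u + ν) ^ μ := by
    have h1 : u ^ μ ≤ (u + ν) ^ μ := by gcongr; linarith
    have h2 : ν ^ μ ≤ (u + ν) ^ μ := by gcongr; linarith
    linarith
  -- Chosen so that factoring out `κ η W^{-b-1}` leaves exactly `C x^{p-1} y`; the term `x^p` of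
  -- Young's inequality then carries the weight of the energy density.
  set y := W ^ (e + b + 1) * η ^ (-δ) / r with hy
  have hy0 : 0 ≤ y := by positivity
  have hY := mul_rpow_sub_one_mul_le hp hC hθ hx hy0
  have hpre : 0 ≤ κ * η * W ^ (-b - 1) := by positivity
  have e1 : C * (κ * x ^ (p - 1)) * W ^ e * (η ^ (1 - δ) / r) =
      κ * η * W ^ (-b - 1) * (C * x ^ (p - 1) * y) := by
    have : W ^ e = W ^ (-b - 1) * W ^ (e + b + 1) := by
      rw [← Real.rpow_add hW0]; ring_nf
    rw [this, hy, sub_eq_add_neg 1 δ, Real.rpow_add h0, Real.rpow_one]; ring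
  have e2 : κ * η * W ^ (-b - 1) * (C ^ p * θ ^ (1 - p) * y ^ p) =
      C ^ p * θ ^ (1 - p) * (1 / r ^ p) * (κ * W ^ q * η ^ (1 - δ * p)) := by
    have h1 : W ^ q = W ^ (-b - 1) * (W ^ (e + b + 1)) ^ p := by
      rw [← Real.rpow_mul hW0.le, ← Real.rpow_add hW0, hq]; ring_nf
    have h2 : η ^ (1 - δ * p) = η * (η ^ (-δ)) ^ p := by
      rw [← Real.rpow_mul h0.le, sub_eq_add_neg, Real.rpow_add h0, Real.rpow_one]; ring_nf
    rw [h1, h2, hy, Real.div_rpow (by positivity) hr.le, Real.mul_rpow (by positivity)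
      (by positivity)]
    ring
  have e3 : κ * W ^ q * η ^ (1 - δ * p) ≤ 2 ^ q * (M ^ c + M ^ (c - 1) * ((u + ν) * η)) := by
    have h1 : W ^ q ≤ 2 ^ q * (u + ν) ^ (μ * q) := by
      calc W ^ q ≤ (2 * (u + ν) ^ μ) ^ q := by gcongr
        _ = _ := by rw [Real.mul_rpow (by norm_num) (by positivity), ← Real.rpow_mul hv.le]
    -- Lowering the exponent of `η` to `c` lets `u + ν` and `η` be joined into a single power of `(u
    -- + ν) η`.
    have h2 : η ^ (1 - δ * p) ≤ η ^ c := Real.rpow_le_rpow_of_exponent_ge h0 hη1 hcδ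
    calc κ * W ^ q * η ^ (1 - δ * p) ≤ (u + ν) ^ d * (2 ^ q * (u + ν) ^ (μ * q)) * η ^ c := by
          gcongr
      _ = 2 ^ q * ((u + ν) * η) ^ c := by
          rw [Real.mul_rpow hv.le hη, hc, Real.rpow_add hv]; ring
      _ ≤ _ := by
          gcongr
          exact rpow_le_rpow_add_mul (by positivity) hM hc0 hc1
  calc _ = κ * η * W ^ (-b - 1) * (C * x ^ (p - 1) * y) := e1
    _ ≤ κ * η * W ^ (-b - 1) * (θ * x ^ p + C ^ p * θ ^ (1 - p) * y ^ p) := by gcongr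
    _ = θ * (η * (κ * x ^ p) * W ^ (-b - 1)) +
        C ^ p * θ ^ (1 - p) * (1 / r ^ p) * (κ * W ^ q * η ^ (1 - δ * p)) := by
        rw [← e2]; ring
    _ ≤ θ * (η * (κ * x ^ p) * W ^ (-b - 1)) + C ^ p * θ ^ (1 - p) * (1 / r ^ p) *
        (2 ^ q * (M ^ c + M ^ (c - 1) * ((u + ν) * η))) := by gcongr
    _ = _ := by ring

/-! ### The decreasing profile used as test function, and its primitive -/

/-- The function `u ↦ (u₊ ^ μ + ε) ^ (-b)`. -/
def profile (μ ε b u : ℝ) : ℝ := (max u 0 ^ μ + ε) ^ (-b)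

/-- The primitive of `profile` that vanishes at the origin. -/
def profilePrimitive (μ ε b u : ℝ) : ℝ := ∫ s in (0 : ℝ)..u, profile μ ε b s

section profile
variable {μ ε b : ℝ}

lemma profile_pos (hε : 0 < ε) (u : ℝ) : 0 < profile μ ε b u := by
  unfold profile; positivity

lemma profile_le (hε : 0 < ε) (hb : 0 ≤ b) (u : ℝ) : profile μ ε b u ≤ ε ^ (-b) := by
  unfold profile
  apply Real.rpow_le_rpow_of_nonpos hε _ (by linarith)
  have : 0 ≤ max u 0 ^ μ := by positivity
  linarith

lemma profile_antitone (hμ : 0 ≤ μ) (hε : 0 < ε) (hb : 0 ≤ b) : Antitone (profile μ ε b) := by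
  intro u v huv
  unfold profile
  apply Real.rpow_le_rpow_of_nonpos (by positivity) _ (by linarith)
  gcongr

/-- The positive part in `profile` keeps the base at least `ε` on the whole line, so continuity and
the bounds need no sign of the argument; `u` is nonnegative only over `Ω_T`. -/
lemma profile_continuous (hμ : 0 < μ) (hε : 0 < ε) : Continuous (profile μ ε b) := by
  unfold profile
  apply Continuous.rpow_const
  · exact ((continuous_id.max continuous_const).rpow_const fun _ => Or.inr hμ.le).add
      continuous_const
  · intro x; left; positivity

lemma profilePrimitive_nonneg (hε : 0 < ε) {u : ℝ} (hu : 0 ≤ u) :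
    0 ≤ profilePrimitive μ ε b u :=
  intervalIntegral.integral_nonneg hu fun s _ => (profile_pos hε s).le

lemma profilePrimitive_sub (hμ : 0 < μ) (hε : 0 < ε) (u v : ℝ) :
    profilePrimitive μ ε b u - profilePrimitive μ ε b v = ∫ s in v..u, profile μ ε b s :=
  intervalIntegral.integral_interval_sub_left
    ((profile_continuous hμ hε).intervalIntegrable _ _)
    ((profile_continuous hμ hε).intervalIntegrable _ _)

/-- Dropping `ε` leaves the majorant `s^{-bμ}`, integrable at the origin because `bμ < 1`. The
resulting bound does not depend on `ε`. -/
lemma profilePrimitive_le (hμ : 0 < μ) (hε : 0 < ε) (hb : 0 < b) (hbμ : b * μ < 1) {u : ℝ}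
    (hu : 0 ≤ u) : profilePrimitive μ ε b u ≤ u ^ (1 - b * μ) / (1 - b * μ) := by
  have h : ∫ s in (0 : ℝ)..u, s ^ (-(b * μ)) = u ^ (1 - b * μ) / (1 - b * μ) := by
    rw [integral_rpow (Or.inl (by linarith)), Real.zero_rpow (by linarith)]
    ring_nf
  rw [← h]
  apply intervalIntegral.integral_mono_on_of_le_Ioo hu
    ((profile_continuous hμ hε).intervalIntegrable _ _)
    (intervalIntegral.intervalIntegrable_rpow' (by linarith))
  intro s hs
  unfold profile
  rw [max_eq_left hs.1.le, show -(b * μ) = μ * (-b) by ring, Real.rpow_mul hs.1.le]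
  have : 0 < s := hs.1
  apply Real.rpow_le_rpow_of_nonpos (by positivity) _ (by linarith)
  linarith

/-- The primitive is concave because its derivative decreases, so it lies below its tangent at `u`.
This inequality replaces the chain rule in time. -/
lemma sub_mul_profile_le (hμ : 0 < μ) (hε : 0 < ε) (hb : 0 ≤ b) (u v : ℝ) :
    (u - v) * profile μ ε b u ≤ profilePrimitive μ ε b u - profilePrimitive μ ε b v := by
  rw [profilePrimitive_sub hμ hε]
  rcases le_total v u with h | h
  · rw [show (u - v) * profile μ ε b u = ∫ _ in v..u, profile μ ε b u by simp]
    apply intervalIntegral.integral_mono_on h (by simp)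
      ((profile_continuous hμ hε).intervalIntegrable _ _)
    intro s hs
    exact profile_antitone hμ.le hε hb hs.2
  · rw [intervalIntegral.integral_symm,
      show (u - v) * profile μ ε b u = -∫ _ in u..v, profile μ ε b u by simp; ring]
    apply neg_le_neg
    apply intervalIntegral.integral_mono_on h
      ((profile_continuous hμ hε).intervalIntegrable _ _) (by simp)
    intro s hs
    exact profile_antitone hμ.le hε hb hs.1

/-- The Lipschitz bound transfers the time continuity of `u` in Lebesgue spaces to integrals of its
primitive. -/
lemma abs_profilePrimitive_sub_le (hμ : 0 < μ) (hε : 0 < ε) (hb : 0 ≤ b) (u v : ℝ) :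
    |profilePrimitive μ ε b u - profilePrimitive μ ε b v| ≤ ε ^ (-b) * |u - v| := by
  rw [profilePrimitive_sub hμ hε, ← Real.norm_eq_abs]
  apply intervalIntegral.norm_integral_le_of_norm_le_const
  intro s _
  rw [Real.norm_eq_abs, abs_of_pos (profile_pos hε s)]
  exact profile_le hε hb s

lemma profilePrimitive_continuous (hμ : 0 < μ) (hε : 0 < ε) :
    Continuous (profilePrimitive μ ε b) :=
  intervalIntegral.continuous_primitive
    (fun _ _ => (profile_continuous hμ hε).intervalIntegrable _ _) 0

end profile

/-! ### Cutoff functions -/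

/-- A power of a standard cutoff function: its gradient is controlled by a power of itself that is
as close to one as desired. -/
lemma exists_cutoff (N : ℕ) (k : ℕ) (hk : 0 < k) : ∃ C : ℝ, 0 < C ∧
    ∀ (y : Space N) (r : ℝ), 0 < r → ∃ η : Space N → ℝ, ContDiff ℝ ∞ η ∧
      (∀ x, 0 ≤ η x) ∧ (∀ x, η x ≤ 1) ∧ (∀ x ∈ ball y r, η x = 1) ∧
      tsupport η ⊆ closedBall y (3 / 2 * r) ∧
      ∀ x, ‖gradient η x‖ ≤ C * (η x ^ (1 - 1 / (k : ℝ)) / r) := by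
  let f : ContDiffBump (0 : Space N) := ⟨1, 3 / 2, by norm_num, by norm_num⟩
  have hf : ContDiff ℝ ∞ (f : Space N → ℝ) := f.contDiff
  obtain ⟨C₀, hC₀⟩ := (hf.continuous_fderiv (by simp)).bounded_above_of_compact_support
    (f.hasCompactSupport.fderiv ℝ)
  refine ⟨k * (|C₀| + 1), by positivity, fun y r hr => ?_⟩
  set l : Space N → Space N := fun x => r⁻¹ • (x - y) with hl
  have hlc : ContDiff ℝ ∞ l := by fun_prop
  have hnorm : ∀ x, ‖l x‖ = dist x y / r := fun x => by
    rw [hl, norm_smul, norm_inv, Real.norm_of_nonneg hr.le, dist_eq_norm]; field_simp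
  have hk0 : (k : ℝ) ≠ 0 := by positivity
  refine ⟨fun x => f (l x) ^ k, (hf.comp hlc).pow k, fun x => pow_nonneg f.nonneg _,
    fun x => pow_le_one₀ f.nonneg f.le_one, fun x hx => ?_, ?_, fun x => ?_⟩
  · have : f (l x) = 1 := f.one_of_mem_closedBall (by
      rw [mem_closedBall_zero_iff, hnorm, div_le_iff₀ hr]
      simpa [f] using (mem_ball.1 hx).le)
    simp [this]
  · apply closure_minimal _ isClosed_closedBall
    intro x hx
    have hx' : f (l x) ≠ 0 := fun h => hx (by simp [h, hk.ne'])
    have : l x ∈ ball (0 : Space N) f.rOut := by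
      rw [← f.support_eq]; exact hx'
    rw [mem_ball_zero_iff, hnorm, div_lt_iff₀ hr] at this
    exact mem_closedBall.2 this.le
  · have hl' : HasFDerivAt l (r⁻¹ • ContinuousLinearMap.id ℝ (Space N)) x :=
      ((hasFDerivAt_id x).sub_const y).const_smul r⁻¹
    have h2 := ((hf.differentiable (by simp) (l x)).hasFDerivAt.comp x hl').pow k
    have hval : ‖fderiv ℝ (fun x => f (l x) ^ k) x‖ =
        k * f (l x) ^ (k - 1) * (‖fderiv ℝ f (l x)‖ / r) := by
      have h3 : fderiv ℝ (fun x => f (l x) ^ k) x = _ := h2.fderiv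
      have : 0 ≤ f (l x) := f.nonneg
      rw [h3, ContinuousLinearMap.comp_smul, ContinuousLinearMap.comp_id, nsmul_eq_mul, norm_smul,
        norm_smul, norm_mul, norm_pow, norm_inv, Real.norm_natCast, Real.norm_of_nonneg hr.le,
        Function.comp, Real.norm_of_nonneg this]
      ring
    have hg : ‖gradient (fun x => f (l x) ^ k) x‖ = ‖fderiv ℝ (fun x => f (l x) ^ k) x‖ := by
      rw [gradient, LinearIsometryEquiv.norm_map]
    -- Differentiating `f^k` loses one factor `f`, which is the fraction `1/k` of the power.
    have hpow : (f (l x) ^ k) ^ (1 - 1 / (k : ℝ)) = f (l x) ^ (k - 1) := by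
      rw [← Real.rpow_natCast, ← Real.rpow_mul f.nonneg, ← Real.rpow_natCast,
        Nat.cast_sub hk]
      congr 1
      field_simp
      simp
    rw [hg, hval, hpow]
    have : ‖fderiv ℝ f (l x)‖ ≤ |C₀| + 1 := (hC₀ _).trans (by linarith [le_abs_self C₀])
    have hf0 : 0 ≤ f (l x) := f.nonneg
    calc (k : ℝ) * f (l x) ^ (k - 1) * (‖fderiv ℝ f (l x)‖ / r)
        ≤ k * f (l x) ^ (k - 1) * ((|C₀| + 1) / r) := by gcongr
      _ = _ := by ring

/-! ### Translations and mollifications in `L^p` -/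

/-- Composition with measure preserving maps is continuous on `L^q`, and translations depend
continuously on the shift. Used for mollification in space and for small shifts in time. -/
lemma tendsto_eLpNorm_translate_sub {V F : Type*} [NormedAddCommGroup V]
    [MeasurableSpace V] [BorelSpace V] [SecondCountableTopology V] {μ : Measure V}
    [LocallyCompactSpace V]
    [μ.IsAddLeftInvariant] [μ.InnerRegularCompactLTTop] [IsLocallyFiniteMeasure μ]
    [NormedAddCommGroup F] {q : ℝ≥0∞} (hq : 1 ≤ q) (hq' : q ≠ ⊤) {f : V → F}
    (hf : MemLp f q μ) :
    Tendsto (fun a : V => eLpNorm (fun x => f (x - a) - f x) q μ) (𝓝 0) (𝓝 0) := by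
  have : Fact (1 ≤ q) := ⟨hq⟩
  let T : C(V, C(V, V)) := (ContinuousMap.mk (fun a : V × V => a.2 - a.1) (by fun_prop)).curry
  have hT : ∀ a, MeasurePreserving (T a) μ μ := fun a => measurePreserving_sub_right μ a
  have h := Filter.Tendsto.compMeasurePreservingLp (l := 𝓝 (0 : V))
    (f := fun _ : V => hf.toLp f) tendsto_const_nhds (T.continuous.tendsto 0) hT (hT 0) hq'
  simp only [Lp.toLp_compMeasurePreserving] at h
  rw [Lp.tendsto_Lp_iff_tendsto_eLpNorm''] at h
  refine h.congr fun a => eLpNorm_congr_ae ?_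
  filter_upwards with x
  change f (x - a) - f (x - 0) = _
  rw [sub_zero]

/-- A sequence of mollifiers shrinking to the origin. -/
def mollifierBump (N n : ℕ) : ContDiffBump (0 : Space N) :=
  ⟨1 / (2 * ((n : ℝ) + 1)), 1 / ((n : ℝ) + 1), by positivity, by
    apply one_div_lt_one_div_of_lt <;> [positivity; linarith [(by positivity : (0:ℝ) < n + 1)]]⟩

lemma tendsto_mollifierBump_rOut (N : ℕ) :
    Tendsto (fun n => (mollifierBump N n).rOut) atTop (𝓝 0) :=
  tendsto_one_div_add_atTop_nhds_zero_nat

/-- The smooth mollifier of unit mass. -/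
def mollifier (N n : ℕ) : Space N → ℝ := (mollifierBump N n).normed volume

/-- The mollification of `f`. -/
def mollify {N : ℕ} {F : Type*} [NormedAddCommGroup F] [NormedSpace ℝ F] (n : ℕ)
    (f : Space N → F) (x : Space N) : F := ∫ z, mollifier N n (x - z) • f z

section mollify
variable {F : Type*} [NormedAddCommGroup F] [NormedSpace ℝ F]

lemma mollifier_nonneg (n : ℕ) (x : Space N) : 0 ≤ mollifier N n x :=
  (mollifierBump N n).nonneg_normed x

lemma mollifier_contDiff (n : ℕ) : ContDiff ℝ ∞ (mollifier N n) :=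
  (mollifierBump N n).contDiff_normed

lemma mollifier_hasCompactSupport (n : ℕ) : HasCompactSupport (mollifier N n) :=
  (mollifierBump N n).hasCompactSupport_normed

lemma mollify_eq_convolution (n : ℕ) (f : Space N → F) :
    mollify n f = convolution (mollifier N n) f (ContinuousLinearMap.lsmul ℝ ℝ) volume := by
  ext x
  rw [convolution_eq_swap]
  rfl

lemma mollify_nonneg (n : ℕ) {f : Space N → ℝ} (hf : ∀ x, 0 ≤ f x) (x : Space N) :
    0 ≤ mollify n f x :=
  integral_nonneg fun z => mul_nonneg (mollifier_nonneg n _) (hf z)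

lemma mollify_contDiff [CompleteSpace F] (n : ℕ) {f : Space N → F}
    (hf : LocallyIntegrable f volume) : ContDiff ℝ ∞ (mollify n f) := by
  rw [mollify_eq_convolution]
  exact (mollifier_hasCompactSupport n).contDiff_convolution_left _ (mollifier_contDiff n) hf

lemma integrable_mollifier_sub_smul (n : ℕ) {f : Space N → F}
    (hf : LocallyIntegrable f volume) (x : Space N) :
    Integrable (fun z => mollifier N n (x - z) • f z) := by
  have := (mollifier_hasCompactSupport (N := N) n).convolutionExists_left
    (ContinuousLinearMap.lsmul ℝ ℝ) (μ := volume) (mollifier_contDiff n).continuous hf x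
  exact ConvolutionExistsAt.integrable_swap this

/-- The mollification error is the mean of the translation errors `f(x - a) - f(x)` against the
probability measure `ρ(a) da`. Jensen's inequality followed by Tonelli bounds its norm by the
largest translation error over the support of `ρ`. -/
lemma eLpNorm_mollify_sub_le [CompleteSpace F] (n : ℕ) {q : ℝ} (hq : 1 ≤ q) {f : Space N → F}
    (hf : MemLp f (ENNReal.ofReal q) volume) (c : ℝ≥0∞)
    (hc : ∀ a ∈ ball (0 : Space N) (mollifierBump N n).rOut,
      eLpNorm (fun x => f (x - a) - f x) (ENNReal.ofReal q) volume ≤ c) :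
    eLpNorm (fun x => mollify n f x - f x) (ENNReal.ofReal q) volume ≤ c := by
  have hq0 : 0 < q := by linarith
  have hqne : ENNReal.ofReal q ≠ 0 := by simpa using hq0
  have hq1 : (1 : ℝ≥0∞) ≤ ENNReal.ofReal q := by simpa using ENNReal.ofReal_le_ofReal hq
  set ρ := mollifier N n with hρ
  have hρm : Measurable ρ := (mollifier_contDiff n).continuous.measurable
  have hloc : LocallyIntegrable f volume := hf.locallyIntegrable hq1
  have hρint : ∫⁻ y, ENNReal.ofReal (ρ y) = 1 := by
    rw [← ofReal_integral_eq_lintegral_ofReal (f := ρ) (mollifierBump N n).integrable_normed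
      (Eventually.of_forall (mollifier_nonneg n))]
    simp [hρ, mollifier, ContDiffBump.integral_normed]
  set m : Measure (Space N) := volume.withDensity (fun y => ENNReal.ofReal (ρ y)) with hm
  have : IsProbabilityMeasure m := ⟨by rw [hm, withDensity_apply _ MeasurableSet.univ]; simpa⟩
  -- Jensen's inequality
  have hjensen : ∀ x, ‖mollify n f x - f x‖ₑ ^ q ≤
      ∫⁻ a, ENNReal.ofReal (ρ a) * ‖f (x - a) - f x‖ₑ ^ q := by
    intro x
    have e1 : mollify n f x = ∫ a, ρ a • f (x - a) := by
      rw [mollify_eq_convolution]; rfl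
    have i1 : Integrable (fun a => ρ a • f (x - a)) := by
      have := (mollifier_hasCompactSupport (N := N) n).convolutionExists_left
        (ContinuousLinearMap.lsmul ℝ ℝ) (μ := volume) (mollifier_contDiff n).continuous hloc x
      exact this.integrable
    have i2 : Integrable (fun a => ρ a • f x) :=
      (mollifierBump N n).integrable_normed.smul_const _
    have e2 : f x = ∫ a, ρ a • f x := by
      rw [integral_smul_const]
      simp [hρ, mollifier, ContDiffBump.integral_normed]
    have e3 : mollify n f x - f x = ∫ a, ρ a • (f (x - a) - f x) := by
      conv_lhs => rw [e1, e2, ← integral_sub i1 i2]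
      simp only [smul_sub]
    have hsm : AEStronglyMeasurable (fun a => f (x - a) - f x) m := by
      have h1 : AEStronglyMeasurable (fun a => f (x - a) - f x) volume :=
        (hf.1.comp_measurePreserving (Measure.measurePreserving_sub_left volume x)).sub
          aestronglyMeasurable_const
      exact h1.mono_ac (withDensity_absolutelyContinuous _ _)
    have e4 : ‖mollify n f x - f x‖ₑ ≤ eLpNorm (fun a => f (x - a) - f x) 1 m := by
      rw [e3, eLpNorm_one_eq_lintegral_enorm, hm,
        lintegral_withDensity_eq_lintegral_mul_non_measurable₀]
      · refine (enorm_integral_le_lintegral_enorm _).trans (le_of_eq ?_)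
        congr 1; ext a
        rw [enorm_smul, Pi.mul_apply, Real.enorm_of_nonneg (mollifier_nonneg n a)]
      · exact hρm.ennreal_ofReal.aemeasurable
      · simp
    have e5 := e4.trans (eLpNorm_le_eLpNorm_of_exponent_le hq1 hsm)
    rw [eLpNorm_eq_lintegral_rpow_enorm_toReal hqne ENNReal.ofReal_ne_top,
      ENNReal.toReal_ofReal hq0.le] at e5
    calc ‖mollify n f x - f x‖ₑ ^ q ≤ ((∫⁻ a, ‖f (x - a) - f x‖ₑ ^ q ∂m) ^ (1 / q)) ^ q := by
          gcongr
      _ = ∫⁻ a, ‖f (x - a) - f x‖ₑ ^ q ∂m := by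
          rw [← ENNReal.rpow_mul, one_div_mul_cancel hq0.ne', ENNReal.rpow_one]
      _ = _ := by
          rw [hm, lintegral_withDensity_eq_lintegral_mul_non_measurable₀]
          · rfl
          · exact hρm.ennreal_ofReal.aemeasurable
          · simp
  rw [eLpNorm_eq_lintegral_rpow_enorm_toReal hqne ENNReal.ofReal_ne_top,
    ENNReal.toReal_ofReal hq0.le, one_div q, ENNReal.rpow_inv_le_iff hq0]
  have hmeas : AEMeasurable (Function.uncurry fun (x a : Space N) =>
      ENNReal.ofReal (ρ a) * ‖f (x - a) - f x‖ₑ ^ q) (volume.prod volume) := by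
    have h1 : AEStronglyMeasurable (fun z : Space N × Space N => f (z.1 - z.2))
        (volume.prod volume) :=
      hf.1.comp_quasiMeasurePreserving (quasiMeasurePreserving_sub_of_right_invariant volume volume)
    have h2 : AEStronglyMeasurable (fun z : Space N × Space N => f z.1)
        (volume.prod volume) := hf.1.comp_fst
    exact (hρm.comp measurable_snd).ennreal_ofReal.aemeasurable.mul
      ((h1.sub h2).enorm.pow_const q)
  calc ∫⁻ x, ‖mollify n f x - f x‖ₑ ^ q
      ≤ ∫⁻ x, ∫⁻ a, ENNReal.ofReal (ρ a) * ‖f (x - a) - f x‖ₑ ^ q :=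
        lintegral_mono fun x => hjensen x
    _ = ∫⁻ a, ∫⁻ x, ENNReal.ofReal (ρ a) * ‖f (x - a) - f x‖ₑ ^ q :=
        lintegral_lintegral_swap hmeas
    _ ≤ ∫⁻ a, ENNReal.ofReal (ρ a) * c ^ q := by
        refine lintegral_mono fun a => ?_
        rw [lintegral_const_mul' _ _ ENNReal.ofReal_ne_top]
        by_cases ha : a ∈ ball (0 : Space N) (mollifierBump N n).rOut
        · gcongr
          have := hc a ha
          rwa [eLpNorm_eq_lintegral_rpow_enorm_toReal hqne ENNReal.ofReal_ne_top,
            ENNReal.toReal_ofReal hq0.le, one_div q, ENNReal.rpow_inv_le_iff hq0] at this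
        · have : ρ a = 0 := by
            rw [← (mollifierBump N n).support_normed_eq (μ := volume)] at ha
            simpa [hρ, mollifier] using ha
          simp [this]
    _ = c ^ q := by
        rw [lintegral_mul_const _ hρm.ennreal_ofReal, hρint, one_mul]

lemma tendsto_eLpNorm_mollify_sub [CompleteSpace F] {q : ℝ} (hq : 1 ≤ q) {f : Space N → F}
    (hf : MemLp f (ENNReal.ofReal q) volume) :
    Tendsto (fun n => eLpNorm (fun x => mollify n f x - f x) (ENNReal.ofReal q) volume)
      atTop (𝓝 0) := by
  have hq1 : (1 : ℝ≥0∞) ≤ ENNReal.ofReal q := by simpa using ENNReal.ofReal_le_ofReal hq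
  rw [ENNReal.tendsto_nhds_zero]
  intro c hc
  have h := ENNReal.tendsto_nhds_zero.1
    (tendsto_eLpNorm_translate_sub hq1 ENNReal.ofReal_ne_top hf) c hc
  obtain ⟨δ, hδ, hball⟩ := Metric.eventually_nhds_iff_ball.1 h
  filter_upwards [(tendsto_mollifierBump_rOut N).eventually (gt_mem_nhds hδ)] with n hn
  exact eLpNorm_mollify_sub_le n hq hf c fun a ha => hball a (ball_subset_ball hn.le ha)

end mollify

section mollify
variable {F : Type*} [NormedAddCommGroup F] [NormedSpace ℝ F]

/-- Lebesgue differentiation, for which the outer and inner radii of the bumps must have a bounded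
ratio; here it is exactly `2`. Pointwise convergence is what passes through the nonlinear function
of `w`. -/
lemma ae_tendsto_mollify [CompleteSpace F] {f : Space N → F} (hf : LocallyIntegrable f volume) :
    ∀ᵐ x, Tendsto (fun n => mollify n f x) atTop (𝓝 (f x)) := by
  have := ContDiffBump.ae_convolution_tendsto_right_of_locallyIntegrable (μ := volume)
    (φ := mollifierBump N) (l := atTop) (K := 2) (tendsto_mollifierBump_rOut N)
    (Eventually.of_forall fun n => by
      change 1 / ((n : ℝ) + 1) ≤ 2 * (1 / (2 * ((n : ℝ) + 1)))
      have : (0 : ℝ) < n + 1 := by positivity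
      apply le_of_eq; field_simp) hf
  filter_upwards [this] with x hx
  simpa only [mollify_eq_convolution, mollifier] using hx

end mollify

lemma tsupport_mollifier_sub_subset (n : ℕ) (x : Space N) :
    tsupport (fun z => mollifier N n (x - z)) ⊆ closedBall x (mollifierBump N n).rOut := by
  apply closure_minimal _ isClosed_closedBall
  intro z hz
  have : x - z ∈ Function.support ((mollifierBump N n).normed volume) := hz
  rw [ContDiffBump.support_normed_eq, mem_ball_zero_iff, ← dist_eq_norm] at this
  rw [mem_closedBall, dist_comm]
  exact this.le

/-- Mollification commutes with the weak gradient, away from the boundary. -/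
lemma gradient_mollify {Ω E : Set (Space N)} (hE : IsCompact E) (hEΩ : E ⊆ Ω)
    {w : Space N → ℝ} {G : Space N → Space N} (h : IsWeakGradient Ω w G) (n : ℕ) {x : Space N}
    (hx : closedBall x (mollifierBump N n).rOut ⊆ E) :
    gradient (mollify n (E.indicator w)) x = mollify n (E.indicator G) x := by
  have hw : LocallyIntegrable (E.indicator w) volume :=
    ((integrable_indicator_iff hE.measurableSet).2
      (h.locallyIntegrable.integrableOn_compact_subset hEΩ hE)).locallyIntegrable
  have hG : LocallyIntegrable (E.indicator G) volume :=
    ((integrable_indicator_iff hE.measurableSet).2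
      (h.locallyIntegrable_grad.integrableOn_compact_subset hEΩ hE)).locallyIntegrable
  set ρ := mollifier N n with hρ
  have hρc : ContDiff ℝ ∞ ρ := mollifier_contDiff n
  have hρs : HasCompactSupport ρ := mollifier_hasCompactSupport n
  set φ : Space N → ℝ := fun z => ρ (x - z) with hφ
  have hφc : ContDiff ℝ ∞ φ := hρc.comp (contDiff_const.sub contDiff_id)
  have hφsub : tsupport φ ⊆ E := (tsupport_mollifier_sub_subset n x).trans hx
  have hφs : HasCompactSupport φ :=
    (isCompact_closedBall x _).of_isClosed_subset (isClosed_tsupport _)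
      (tsupport_mollifier_sub_subset n x)
  have hdφ : ∀ z e, fderiv ℝ φ z e = - fderiv ℝ ρ (x - z) e := by
    intro z e
    have h1 : HasFDerivAt (fun z : Space N => x - z) (-ContinuousLinearMap.id ℝ (Space N)) z :=
      (hasFDerivAt_id z).const_sub x
    have h2 := ((hρc.differentiable (by simp) (x - z)).hasFDerivAt.comp z h1).fderiv
    have h3 : fderiv ℝ φ z = _ := h2
    rw [h3]; simp
  have hderiv := hρs.hasFDerivAt_convolution_left (ContinuousLinearMap.lsmul ℝ ℝ) (μ := volume)
    (hρc.of_le (by simp)) hw x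
  apply ext_inner_right ℝ
  intro e
  have e1 : inner ℝ (gradient (mollify n (E.indicator w)) x) e =
      ∫ z, fderiv ℝ ρ (x - z) e * E.indicator w z := by
    rw [gradient, InnerProductSpace.toDual_symm_apply, mollify_eq_convolution, hderiv.fderiv,
      convolution_eq_swap, ContinuousLinearMap.integral_apply]
    · rfl
    · have := (hρs.fderiv ℝ).convolutionExists_left
        ((ContinuousLinearMap.lsmul ℝ ℝ).precompL (Space N)) (μ := volume)
        (hρc.continuous_fderiv (by simp)) hw x
      exact ConvolutionExistsAt.integrable_swap this
  have e2 : inner ℝ (mollify n (E.indicator G) x) e =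
      ∫ z, φ z * inner ℝ (E.indicator G z) e := by
    have hi := integrable_mollifier_sub_smul n hG x
    rw [mollify, real_inner_comm]
    have := (innerSL ℝ e).integral_comp_comm hi
    simp only [innerSL_apply_apply] at this
    rw [← this]
    congr 1; ext z
    rw [inner_smul_right, real_inner_comm]
  -- The mollifier centred at `x` lives inside `E`, so truncating `w` and `G` to `E` is invisible to
  -- it and the jump across `∂E` contributes nothing.
  have hoff : ∀ z, z ∉ E → φ z = 0 ∧ ∀ e, fderiv ℝ φ z e = 0 := by
    intro z hz
    have h1 : z ∉ tsupport φ := fun h => hz (hφsub h)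
    refine ⟨image_eq_zero_of_notMem_tsupport h1, fun e => ?_⟩
    have h2 : z ∉ tsupport (fderiv ℝ φ) := fun h => h1 (tsupport_fderiv_subset ℝ h)
    rw [image_eq_zero_of_notMem_tsupport h2]; rfl
  have hset : ∀ k : Space N → ℝ, (∀ z, z ∉ E → k z = 0) → ∫ z in Ω, k z = ∫ z, k z := by
    intro k hk
    exact setIntegral_eq_integral_of_forall_compl_eq_zero fun z hz => hk z fun h => hz (hEΩ h)
  have h0 := h.integral_eq φ hφc hφs (hφsub.trans hEΩ) e
  rw [hset _ (fun z hz => by rw [(hoff z hz).2, mul_zero]),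
    hset _ (fun z hz => by rw [(hoff z hz).1, zero_mul])] at h0
  rw [e1, e2]
  have e3 : ∫ z, fderiv ℝ ρ (x - z) e * E.indicator w z = - ∫ z, w z * fderiv ℝ φ z e := by
    rw [← integral_neg]
    congr 1; ext z
    by_cases hz : z ∈ E
    · rw [indicator_of_mem hz, hdφ]; ring
    · rw [indicator_of_notMem hz, (hoff z hz).2]; ring
  have e4 : ∫ z, φ z * inner ℝ (E.indicator G z) e = ∫ z, φ z * inner ℝ (G z) e := by
    congr 1; ext z
    by_cases hz : z ∈ E
    · rw [indicator_of_mem hz]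
    · rw [(hoff z hz).1]; ring
  rw [e3, e4, h0, neg_neg]

/-! ### Dominated convergence and the chain rule in `W₀^{1,p}` -/

lemma tendsto_eLpNorm_zero_of_dominated {α F : Type*} [MeasurableSpace α] {m : Measure α}
    [NormedAddCommGroup F] {q : ℝ} (hq : 0 < q) {f : ℕ → α → F} {g : α → ℝ}
    (hf : ∀ n, AEStronglyMeasurable (f n) m) (hg : MemLp g (ENNReal.ofReal q) m)
    (hfg : ∀ n, ∀ᵐ x ∂m, ‖f n x‖ ≤ g x)
    (hlim : ∀ᵐ x ∂m, Tendsto (fun n => f n x) atTop (𝓝 0)) :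
    Tendsto (fun n => eLpNorm (f n) (ENNReal.ofReal q) m) atTop (𝓝 0) := by
  have hq0 : ENNReal.ofReal q ≠ 0 := by simpa using hq
  simp only [eLpNorm_eq_lintegral_rpow_enorm_toReal hq0 ENNReal.ofReal_ne_top,
    ENNReal.toReal_ofReal hq.le]
  have h1 : Tendsto (fun n => ∫⁻ x, ‖f n x‖ₑ ^ q ∂m) atTop (𝓝 (∫⁻ _, 0 ∂m)) := by
    apply tendsto_lintegral_of_dominated_convergence' (fun x => ‖g x‖ₑ ^ q)
    · exact fun n => (hf n).enorm.pow_const q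
    · intro n
      filter_upwards [hfg n] with x hx
      gcongr
      exact enorm_le_iff_norm_le.2 (hx.trans (le_abs_self _))
    · have := lintegral_rpow_enorm_lt_top_of_eLpNorm_lt_top hq0 ENNReal.ofReal_ne_top hg.2
      rw [ENNReal.toReal_ofReal hq.le] at this
      exact this.ne
    · filter_upwards [hlim] with x hx
      have := (ENNReal.continuous_rpow_const (y := q)).tendsto 0 |>.comp
        ((continuous_enorm.tendsto (0 : F)).comp hx |>.trans (by simp))
      simpa [ENNReal.zero_rpow_of_pos hq, Function.comp_def] using this
  have := (ENNReal.continuous_rpow_const (y := 1 / q)).tendsto _ |>.comp h1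
  simpa [ENNReal.zero_rpow_of_pos (inv_pos.2 hq), Function.comp_def] using this

lemma rpow_add_const_hasDerivAt {ε b x : ℝ} (hε : 0 < ε) (hx : 0 ≤ x) :
    HasDerivAt (fun s : ℝ => (s + ε) ^ (-b)) (-b * (x + ε) ^ (-b - 1)) x := by
  have := ((hasDerivAt_id x).add_const ε).rpow_const (p := -b) (Or.inl (by simp; positivity))
  simpa using this

set_option maxHeartbeats 400000 in
/-- The chain and product rules for `η (w + ε)^{-b}`, where `w ≥ 0` is a Sobolev function: the
product belongs to `W₀^{1,p}`. -/
lemma memW0_cutoff_mul_rpow {Ω : Set (Space N)} {y : Space N} {R R' p ε b : ℝ}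
    (hp : 1 < p) (hR : R < R') (hsub : closedBall y R' ⊆ Ω) {w : Space N → ℝ}
    {G : Space N → Space N} (h : IsWeakGradient Ω w G) (hw0 : ∀ x ∈ Ω, 0 ≤ w x)
    (hwp : MemLp w (ENNReal.ofReal p) (volume.restrict (closedBall y R')))
    (hGp : MemLp G (ENNReal.ofReal p) (volume.restrict (closedBall y R')))
    (hε : 0 < ε) (hb : 0 < b) {η : Space N → ℝ} (hη : ContDiff ℝ ∞ η) (hη0 : ∀ x, 0 ≤ η x)
    (hη1 : ∀ x, η x ≤ 1) (hηs : tsupport η ⊆ ball y R) :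
    MemW0 (closedBall y R) p (fun x => η x * (w x + ε) ^ (-b))
      (fun x => (w x + ε) ^ (-b) • gradient η x + (η x * (-b * (w x + ε) ^ (-b - 1))) • G x) := by
  set E' := closedBall y R' with hE'
  set E := closedBall y R with hE
  have hEE' : E ⊆ E' := closedBall_subset_closedBall hR.le
  have hE'c : IsCompact E' := isCompact_closedBall y R'
  have hE'm : MeasurableSet E' := hE'c.measurableSet
  have hp1 : (1 : ℝ≥0∞) ≤ ENNReal.ofReal p := by simpa using ENNReal.ofReal_le_ofReal hp.le
  have hηc : HasCompactSupport η := (isCompact_closedBall y R).of_isClosed_subset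
    (isClosed_tsupport _) (hηs.trans ball_subset_closedBall)
  have hw1 : MemLp (E'.indicator w) (ENNReal.ofReal p) volume :=
    (memLp_indicator_iff_restrict hE'm).2 hwp
  have hG1 : MemLp (E'.indicator G) (ENNReal.ofReal p) volume :=
    (memLp_indicator_iff_restrict hE'm).2 hGp
  have hwl := hw1.locallyIntegrable hp1
  have hGl := hG1.locallyIntegrable hp1
  set v : ℕ → Space N → ℝ := fun n => mollify n (E'.indicator w) with hv
  have hvc : ∀ n, ContDiff ℝ ∞ (v n) := fun n => mollify_contDiff n hwl
  have hv0 : ∀ n x, 0 ≤ v n x := fun n x => mollify_nonneg n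
    (indicator_nonneg fun z hz => hw0 z (hsub hz)) x
  have hvpos : ∀ n x, 0 < v n x + ε := fun n x => add_pos_of_nonneg_of_pos (hv0 n x) hε
  have hgc : Continuous (gradient η) := by
    unfold gradient
    exact (LinearIsometryEquiv.continuous _).comp (hη.continuous_fderiv (by simp))
  obtain ⟨C₀, hC₀⟩ := hgc.bounded_above_of_compact_support (by
    refine (hηc.fderiv ℝ).comp_left (g := (InnerProductSpace.toDual ℝ (Space N)).symm) (by simp))
  have hC₀0 : 0 ≤ C₀ := (norm_nonneg _).trans (hC₀ 0)
  have hζc : ∀ n, ContDiff ℝ ∞ (fun x => η x * (v n x + ε) ^ (-b)) := fun n =>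
    hη.mul (((hvc n).add contDiff_const).rpow_const_of_ne fun x => (hvpos n x).ne')
  have hgrad : ∀ n x, gradient (fun x => η x * (v n x + ε) ^ (-b)) x =
      (v n x + ε) ^ (-b) • gradient η x +
        (η x * (-b * (v n x + ε) ^ (-b - 1))) • gradient (v n) x := by
    intro n x
    have h1 := (hη.differentiable (by simp) x).hasFDerivAt
    have h2 := ((hvc n).differentiable (by simp) x).hasFDerivAt
    have h3 := (rpow_add_const_hasDerivAt (b := b) hε (hv0 n x)).comp_hasFDerivAt x h2
    have h4 := (h1.mul h3).fderiv
    have h5 : fderiv ℝ (fun x => η x * (v n x + ε) ^ (-b)) x = _ := h4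
    rw [gradient, h5]
    simp only [map_add, map_smul, gradient, Function.comp]
    rw [smul_smul, add_comm]
  have hloc : ∀ᶠ n in atTop, ∀ x ∈ E, gradient (v n) x = mollify n (E'.indicator G) x := by
    filter_upwards [(tendsto_mollifierBump_rOut N).eventually
      (gt_mem_nhds (sub_pos.2 hR))] with n hn x hx
    refine gradient_mollify hE'c hsub h n fun z hz => ?_
    have h1 := dist_triangle z x y
    have h2 : dist z x ≤ _ := hz
    have h3 : dist x y ≤ R := hx
    exact mem_closedBall.2 (by linarith)
  have haew : ∀ᵐ x ∂(volume.restrict E), Tendsto (fun n => v n x) atTop (𝓝 (w x)) := by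
    filter_upwards [ae_restrict_of_ae (ae_tendsto_mollify hwl),
      ae_restrict_mem measurableSet_closedBall] with x hx hxE
    rwa [indicator_of_mem (hEE' hxE)] at hx
  have hw0' : ∀ᵐ x ∂(volume.restrict E), 0 ≤ w x := by
    filter_upwards [ae_restrict_mem measurableSet_closedBall] with x hx
    exact hw0 x (hsub (hEE' hx))
  have hbd : ∀ s : ℝ, 0 ≤ s → ∀ e : ℝ, e ≤ 0 → 0 ≤ (s + ε) ^ e ∧ (s + ε) ^ e ≤ ε ^ e := fun s hs e he =>
    
    ⟨by positivity, Real.rpow_le_rpow_of_nonpos hε (by linarith) he⟩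
  have hpow : ∀ e : ℝ, ∀ x, 0 ≤ w x → Tendsto (fun n => v n x) atTop (𝓝 (w x)) →
      Tendsto (fun n => (v n x + ε) ^ e - (w x + ε) ^ e) atTop (𝓝 0) := by
    intro e x hx ht
    have := (ht.add_const ε).rpow_const (p := e) (Or.inl (by positivity))
    simpa using this.sub_const ((w x + ε) ^ e)
  have hwm : AEMeasurable w (volume.restrict E) :=
    (hwp.1.mono_measure (Measure.restrict_mono hEE' le_rfl)).aemeasurable
  have hGm : AEStronglyMeasurable G (volume.restrict E) :=
    hGp.1.mono_measure (Measure.restrict_mono hEE' le_rfl)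
  have hpm : ∀ n, ∀ e : ℝ, AEStronglyMeasurable
      (fun x => (v n x + ε) ^ e - (w x + ε) ^ e) (volume.restrict E) := fun n e =>
    ((((hvc n).continuous.measurable.add_const ε).pow_const e).aemeasurable.sub
      ((hwm.add_const ε).pow_const e)).aestronglyMeasurable
  have hηm : AEStronglyMeasurable η (volume.restrict E) := hη.continuous.aestronglyMeasurable
  have hgm : AEStronglyMeasurable (gradient η) (volume.restrict E) := hgc.aestronglyMeasurable
  have hdiff : ∀ n, ∀ e : ℝ, e ≤ 0 → ∀ x, 0 ≤ w x →
      |(v n x + ε) ^ e - (w x + ε) ^ e| ≤ ε ^ e := by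
    intro n e he x hx
    have h1 := hbd _ (hv0 n x) e he
    have h2 := hbd _ hx e he
    rw [abs_le]; constructor <;> linarith [h1.1, h1.2, h2.1, h2.2]
  have : IsFiniteMeasure (volume.restrict E) :=
    isFiniteMeasure_restrict.2 (isCompact_closedBall y R).measure_lt_top.ne
  -- The approximants replace `w` by its mollification inside the nonlinearity. They are smooth
  -- because `v n + ε` stays positive.
  refine ⟨fun n x => η x * (v n x + ε) ^ (-b), fun n => ⟨hζc n, hηc.mul_right, ?_⟩, ?_, ?_⟩
  · exact (closure_mono (Function.support_mul_subset_left _ _)).trans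
      (hηs.trans ball_subset_interior_closedBall)
  · refine tendsto_eLpNorm_zero_of_dominated (by linarith) (g := fun _ => ε ^ (-b)) ?_
      (memLp_const _) ?_ ?_
    · intro n
      simp only [← mul_sub]
      exact hηm.mul (hpm n (-b))
    · intro n
      filter_upwards [hw0'] with x hx
      rw [← mul_sub, norm_mul, Real.norm_of_nonneg (hη0 x), Real.norm_eq_abs]
      calc _ ≤ 1 * ε ^ (-b) := mul_le_mul (hη1 x) (hdiff n _ (by linarith) x hx)
            (abs_nonneg _) zero_le_one
        _ = _ := one_mul _
    · filter_upwards [hw0', haew] with x hx ht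
      simpa only [← mul_sub, mul_zero] using (hpow (-b) x hx ht).const_mul (η x)
  -- The gradient error splits in two. `D` keeps the true gradient `G` and varies only the
  -- coefficients, which converge almost everywhere and are bounded, so it is dominated by a
  -- multiple of `1 + ‖G‖`. The other part, `Z` below, is a bounded coefficient times the
  -- mollification error `H` of `G`.
  · set D : ℕ → Space N → Space N := fun n x =>
      ((v n x + ε) ^ (-b) - (w x + ε) ^ (-b)) • gradient η x +
        (η x * (-b * ((v n x + ε) ^ (-b - 1) - (w x + ε) ^ (-b - 1)))) • G x with hD
    have hDm : ∀ n, AEStronglyMeasurable (D n) (volume.restrict E) := by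
      intro n
      have h1 := (hpm n (-b)).smul hgm
      have h2 := (hηm.mul ((hpm n (-b - 1)).const_mul (-b))).smul hGm
      exact h1.add h2
    have hDlim : Tendsto (fun n => eLpNorm (D n) (ENNReal.ofReal p) (volume.restrict E))
        atTop (𝓝 0) := by
      refine tendsto_eLpNorm_zero_of_dominated (by linarith)
        (g := fun x => ε ^ (-b) * C₀ + b * ε ^ (-b - 1) * ‖G x‖) hDm ?_ ?_ ?_
      · have h1 : MemLp (fun x => b * ε ^ (-b - 1) * ‖G x‖) (ENNReal.ofReal p)
            (volume.restrict E) :=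
          (hGp.mono_measure (Measure.restrict_mono hEE' le_rfl)).norm.const_mul _
        have h2 : MemLp (fun _ : Space N => ε ^ (-b) * C₀) (ENNReal.ofReal p)
            (volume.restrict E) := memLp_const _
        exact h2.add h1
      · intro n
        filter_upwards [hw0'] with x hx
        refine (norm_add_le _ _).trans (add_le_add ?_ ?_)
        · rw [norm_smul, Real.norm_eq_abs]
          have := hdiff n (-b) (by linarith) x hx
          exact mul_le_mul this (hC₀ x) (norm_nonneg _) (by positivity)
        · rw [norm_smul, norm_mul, norm_mul, Real.norm_of_nonneg (hη0 x), norm_neg,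
            Real.norm_of_nonneg hb.le, Real.norm_eq_abs]
          have h1 := hdiff n (-b - 1) (by linarith) x hx
          have h2 : η x * (b * |(v n x + ε) ^ (-b - 1) - (w x + ε) ^ (-b - 1)|) ≤
              1 * (b * ε ^ (-b - 1)) := by
            apply mul_le_mul (hη1 x) _ (by positivity) zero_le_one
            gcongr
          rw [one_mul] at h2
          gcongr
      · filter_upwards [hw0', haew] with x hx ht
        have h1 := (hpow (-b) x hx ht).smul_const (gradient η x)
        have h2 := (((hpow (-b - 1) x hx ht).const_mul (-b)).const_mul (η x)).smul_const (G x)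
        have h3 := h1.add h2
        simp only [mul_zero, zero_smul, add_zero] at h3
        exact h3
    set H : ℕ → Space N → Space N := fun n x =>
      mollify n (E'.indicator G) x - E'.indicator G x with hH
    have hHm : ∀ n, AEStronglyMeasurable (H n) volume := fun n =>
      (mollify_contDiff n hGl).continuous.aestronglyMeasurable.sub hG1.1
    have hHlim := tendsto_eLpNorm_mollify_sub hp.le hG1
    have hbound : ∀ᶠ n in atTop, eLpNorm (fun x =>
        gradient (fun x => η x * (v n x + ε) ^ (-b)) x -
          ((w x + ε) ^ (-b) • gradient η x + (η x * (-b * (w x + ε) ^ (-b - 1))) • G x))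
        (ENNReal.ofReal p) (volume.restrict E) ≤
        eLpNorm (D n) (ENNReal.ofReal p) (volume.restrict E) +
          ENNReal.ofReal (b * ε ^ (-b - 1)) * eLpNorm (H n) (ENNReal.ofReal p) volume := by
      filter_upwards [hloc] with n hn
      set Z : Space N → Space N := fun x => (η x * (-b * (v n x + ε) ^ (-b - 1))) • H n x with hZ
      have hZm : AEStronglyMeasurable Z (volume.restrict E) := by
        have h1 : Continuous fun x => η x * (-b * (v n x + ε) ^ (-b - 1)) :=
          hη.continuous.mul (continuous_const.mul
            (((hvc n).continuous.add continuous_const).rpow_const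
              fun x => Or.inl (hvpos n x).ne'))
        exact h1.aestronglyMeasurable.smul (hHm n).restrict
      have e1 : (fun x => gradient (fun x => η x * (v n x + ε) ^ (-b)) x -
          ((w x + ε) ^ (-b) • gradient η x + (η x * (-b * (w x + ε) ^ (-b - 1))) • G x))
          =ᵐ[volume.restrict E] D n + Z := by
        filter_upwards [ae_restrict_mem measurableSet_closedBall] with x hx
        rw [hgrad, hn x hx, Pi.add_apply, hD, hZ, hH]
        simp only [indicator_of_mem (hEE' hx)]
        module
      rw [eLpNorm_congr_ae e1]
      refine (eLpNorm_add_le (hDm n) hZm hp1).trans (add_le_add_right ?_ _)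
      have e2 : ∀ᵐ x ∂(volume.restrict E), ‖Z x‖ ≤ b * ε ^ (-b - 1) * ‖H n x‖ := by
        filter_upwards with x
        have h1 := hbd _ (hv0 n x) (-b - 1) (by linarith)
        rw [hZ, norm_smul, norm_mul, norm_mul, Real.norm_of_nonneg (hη0 x), norm_neg,
            Real.norm_of_nonneg hb.le, Real.norm_of_nonneg h1.1]
        have h2 : η x * (b * (v n x + ε) ^ (-b - 1)) ≤ 1 * (b * ε ^ (-b - 1)) := by
          apply mul_le_mul (hη1 x) _ (mul_nonneg hb.le h1.1) zero_le_one
          exact mul_le_mul_of_nonneg_left h1.2 hb.le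
        rw [one_mul] at h2
        gcongr
      refine (eLpNorm_le_mul_eLpNorm_of_ae_le_mul e2 _).trans ?_
      gcongr
      exact Measure.restrict_le_self
    refine tendsto_of_tendsto_of_tendsto_of_le_of_le' tendsto_const_nhds ?_
      (Eventually.of_forall fun _ => zero_le) hbound
    have h2 := ENNReal.Tendsto.const_mul (a := ENNReal.ofReal (b * ε ^ (-b - 1))) hHlim
      (Or.inr ENNReal.ofReal_ne_top)
    simpa using hDlim.add h2

/-! ### The flux -/

/-- The factor `u^{(m-m⁻)(p-1)}` of the structure conditions, set to zero where `u = 0`. -/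
def fluxWeight (m p v : ℝ) : ℝ := if 0 < v then v ^ ((m - mMinus m) * (p - 1)) else 0

lemma mMinus_pos {m : ℝ} (hm : 0 < m) : 0 < mMinus m := lt_min one_pos hm

lemma mMinus_le_one (m : ℝ) : mMinus m ≤ 1 := min_le_left _ _

lemma mMinus_le (m : ℝ) : mMinus m ≤ m := min_le_right _ _

lemma fluxWeight_nonneg (m p v : ℝ) : 0 ≤ fluxWeight m p v := by
  unfold fluxWeight
  split_ifs with h
  · positivity
  · rfl

lemma fluxWeight_le {m p v M : ℝ} (hp : 1 < p) (hM : 0 ≤ M) (hv : v ≤ M) :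
    fluxWeight m p v ≤ M ^ ((m - mMinus m) * (p - 1)) := by
  unfold fluxWeight
  split_ifs with h
  · have := mul_nonneg (sub_nonneg.2 (mMinus_le m)) (sub_nonneg.2 hp.le)
    gcongr
  · positivity

lemma gradPow_smul {m v : ℝ} (hm : 0 < m) (hv : 0 < v) (w : Space N) :
    gradPow m v ((1 / mMinus m * v ^ (1 - mMinus m)) • w) = w := by
  have h0 := (mMinus_pos hm).ne'
  have : v ^ (mMinus m - 1) * v ^ (1 - mMinus m) = 1 := by
    rw [← Real.rpow_add hv]; simp
  rw [gradPow, smul_smul]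
  have h1 : mMinus m * v ^ (mMinus m - 1) * (1 / mMinus m * v ^ (1 - mMinus m)) = 1 := by
    calc _ = (mMinus m * (1 / mMinus m)) * (v ^ (mMinus m - 1) * v ^ (1 - mMinus m)) := by ring
      _ = 1 := by rw [this, mul_one_div_cancel h0, one_mul]
  rw [h1, one_smul]

/-- Rewrites the structure conditions in the variable `w = Du^μ`, the only gradient available for a
solution. With the weight set to zero for `v ≤ 0` they hold for every real `v`. -/
lemma flux_bounds {Ω : Set (Space N)} {T m p K₁ K₂ : ℝ} {A : Space N → ℝ → ℝ → Space N → Space N}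
    (hm : 0 < m) (hA : StructureConditions Ω T m p K₁ K₂ A) :
    ∀ᵐ z : Space N × ℝ ∂(volume.restrict (spaceTime Ω T)), ∀ (v : ℝ) (w : Space N),
      ‖flux A m z.1 z.2 v w‖ ≤ K₂ * (fluxWeight m p v * ‖w‖ ^ (p - 1)) ∧
      K₁ * (fluxWeight m p v * ‖w‖ ^ p) ≤ inner ℝ (flux A m z.1 z.2 v w) w := by
  filter_upwards [hA.coercive, hA.growth] with z h1 h2 v w
  unfold flux fluxWeight
  split_ifs with hv
  · have e1 := h1 v hv ((1 / mMinus m * v ^ (1 - mMinus m)) • w)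
    have e2 := h2 v hv ((1 / mMinus m * v ^ (1 - mMinus m)) • w)
    rw [gradPow_smul hm hv] at e1 e2
    exact ⟨by linarith, by linarith⟩
  · simp

/-- Approximate `g` by simple functions with values in `s`. On each fibre the composite is `F` with
a fixed second argument, hence measurable, and continuity on `s` passes this to the limit. -/
lemma aemeasurable_of_caratheodory {α X Y : Type*} [MeasurableSpace α] {μ : Measure α}
    [PseudoEMetricSpace X] [MeasurableSpace X] [OpensMeasurableSpace X]
    [SecondCountableTopology X] [MeasurableSingletonClass X]
    [TopologicalSpace Y] [TopologicalSpace.PseudoMetrizableSpace Y] [MeasurableSpace Y]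
    [BorelSpace Y] {s : Set X} {F : α → X → Y} (hF : ∀ x ∈ s, AEMeasurable (fun a => F a x) μ)
    (hFc : ∀ᵐ a ∂μ, ContinuousOn (F a) s) {g : α → X} (hg : Measurable g) (hgs : ∀ a, g a ∈ s)
    {x₀ : X} (hx₀ : x₀ ∈ s) : AEMeasurable (fun a => F a (g a)) μ := by
  set φ := SimpleFunc.approxOn g hg s x₀ hx₀ with hφ
  refine aemeasurable_of_tendsto_metrizable_ae atTop (f := fun n a => F a (φ n a)) ?_ ?_
  · intro n
    have hU : (⋃ x : (φ n).range, φ n ⁻¹' {x.1}) = univ := by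
      ext a; simp
    rw [← Measure.restrict_univ (μ := μ), ← hU, aemeasurable_iUnion_iff]
    rintro ⟨x, hx⟩
    have hxs : x ∈ s := by
      obtain ⟨a, rfl⟩ := SimpleFunc.mem_range.1 hx
      exact SimpleFunc.approxOn_mem hg hx₀ n a
    refine (hF x hxs).restrict.congr ?_
    filter_upwards [ae_restrict_mem ((φ n).measurableSet_fiber x)] with a ha
    rw [show φ n a = x from ha]
  · filter_upwards [hFc] with a ha
    have h1 : Tendsto (fun n => φ n a) atTop (𝓝 (g a)) :=
      SimpleFunc.tendsto_approxOn hg hx₀ (subset_closure (hgs a))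
    exact (ha (g a) (hgs a)).tendsto.comp (tendsto_nhdsWithin_iff.2
      ⟨h1, Eventually.of_forall fun n => SimpleFunc.approxOn_mem hg hx₀ n a⟩)

lemma flux_aestronglyMeasurable {Ω : Set (Space N)} {T m : ℝ}
    {A : Space N → ℝ → ℝ → Space N → Space N} (hA : IsCaratheodory Ω T A)
    {S : Set (Space N × ℝ)} (hS : S ⊆ spaceTime Ω T) {u : Space N → ℝ → ℝ}
    {G : Space N → ℝ → Space N}
    (hu : AEMeasurable (fun z : Space N × ℝ => u z.1 z.2) (volume.restrict S))
    (hG : AEMeasurable (fun z : Space N × ℝ => G z.1 z.2) (volume.restrict S)) :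
    AEStronglyMeasurable (fun z : Space N × ℝ => flux A m z.1 z.2 (u z.1 z.2) (G z.1 z.2))
      (volume.restrict S) := by
  classical
  set u' := hu.mk with hu'
  set G' := hG.mk with hG'
  have hpos : MeasurableSet {z | 0 < u' z} := measurableSet_lt measurable_const hu.measurable_mk
  -- The value `(1, 0)` is arbitrary; it keeps `g` inside the domain `(0, ∞) × ℝ^N` of `A` where `u`
  -- vanishes, a region cut off again in `h2`.
  set g : Space N × ℝ → ℝ × Space N := fun z => if 0 < u' z then
    (u' z, (1 / mMinus m * u' z ^ (1 - mMinus m)) • G' z) else (1, 0) with hg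
  have hgm : Measurable g := by
    refine Measurable.ite hpos ?_ measurable_const
    have h1 : Measurable fun z => 1 / mMinus m * u' z ^ (1 - mMinus m) :=
      (hu.measurable_mk.pow_const _).const_mul _
    exact hu.measurable_mk.prodMk (h1.smul hG.measurable_mk)
  have hgs : ∀ z, g z ∈ (Ioi (0 : ℝ)) ×ˢ (univ : Set (Space N)) := by
    intro z
    simp only [hg]
    split_ifs with h
    · exact ⟨h, mem_univ _⟩
    · exact ⟨zero_lt_one (α := ℝ), mem_univ _⟩
  have hle : volume.restrict S ≤ volume.restrict (spaceTime Ω T) := Measure.restrict_mono hS le_rfl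
  have h := aemeasurable_of_caratheodory (μ := volume.restrict S)
    (s := (Ioi (0 : ℝ)) ×ˢ (univ : Set (Space N)))
    (F := fun (z : Space N × ℝ) (w : ℝ × Space N) => A z.1 z.2 w.1 w.2)
    (fun x hx => (hA.measurable x.1 hx.1 x.2).mono_measure hle)
    (ae_mono hle hA.continuous) hgm hgs
    (x₀ := (1, 0)) ⟨zero_lt_one (α := ℝ), mem_univ _⟩
  have h2 : AEMeasurable (fun z => if 0 < u' z then A z.1 z.2 (g z).1 (g z).2 else 0)
      (volume.restrict S) := by
    have := h.indicator hpos
    refine this.congr (Eventually.of_forall fun z => ?_)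
    simp only [indicator, mem_ofPred_eq]
  refine (h2.congr ?_).aestronglyMeasurable
  filter_upwards [hu.ae_eq_mk, hG.ae_eq_mk] with z h3 h4
  unfold flux
  rw [h3, h4]
  split_ifs with h5
  · simp only [hg, if_pos h5]
    rfl
  · rfl

/-- The weight has a nonnegative exponent and `u` is bounded on `K`, so the flux is bounded by a
multiple of `‖G‖^{p-1}`. This makes it a Hölder partner of spatial gradients in `L^p`. -/
lemma flux_memLp {Ω : Set (Space N)} {T m p K₁ K₂ : ℝ} (hm : 0 < m) (hp : 1 < p) (hK₂ : 0 < K₂)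
    {A : Space N → ℝ → ℝ → Space N → Space N} (hA : IsCaratheodory Ω T A)
    (hA' : StructureConditions Ω T m p K₁ K₂ A) {u : Space N → ℝ → ℝ} {G : Space N → ℝ → Space N}
    (hu : IsLocalWeakSolutionWith Ω T m p A u G) {K : Set (Space N × ℝ)} (hK : IsCompact K)
    (hKΩ : K ⊆ spaceTime Ω T) :
    MemLp (fun z : Space N × ℝ => flux A m z.1 z.2 (u z.1 z.2) (G z.1 z.2))
      (ENNReal.ofReal (p / (p - 1))) (volume.restrict K) := by
  have hub := hu.locally_bounded K hK hKΩ
  have hG := hu.memLp_grad K hK hKΩ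
  have hle : volume.restrict K ≤ volume.restrict (spaceTime Ω T) := Measure.restrict_mono hKΩ le_rfl
  obtain ⟨M, hM0, hM⟩ : ∃ M : ℝ, 0 ≤ M ∧ ∀ᵐ z ∂(volume.restrict K), u z.1 z.2 ≤ M := by
    have h1 := hub.2
    rw [eLpNorm_exponent_top] at h1
    refine ⟨(eLpNormEssSup (fun z : Space N × ℝ => u z.1 z.2) (volume.restrict K)).toReal,
      ENNReal.toReal_nonneg, ?_⟩
    filter_upwards [ae_le_eLpNormEssSup (f := fun z : Space N × ℝ => u z.1 z.2)] with z hz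
    have := ENNReal.toReal_mono h1.ne hz
    rw [toReal_enorm] at this
    exact (le_abs_self _).trans this
  have h1 := hG.norm_rpow_div (ENNReal.ofReal (p - 1))
  rw [ENNReal.toReal_ofReal (by linarith), ← ENNReal.ofReal_div_of_pos (by linarith)] at h1
  refine (h1.const_mul (K₂ * M ^ ((m - mMinus m) * (p - 1)))).of_le
    (flux_aestronglyMeasurable hA hKΩ hub.1.aemeasurable hG.1.aemeasurable) ?_
  filter_upwards [hM, ae_mono hle (flux_bounds hm hA')] with z hz hfl
  refine (hfl _ _).1.trans ?_
  refine le_trans ?_ (le_abs_self _)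
  have := fluxWeight_le (m := m) hp hM0 hz
  have h3 : 0 ≤ ‖G z.1 z.2‖ ^ (p - 1) := by positivity
  calc _ = K₂ * fluxWeight m p (u z.1 z.2) * ‖G z.1 z.2‖ ^ (p - 1) := by ring
    _ ≤ _ := by gcongr

instance isAddHaarMeasure_volume_spaceTime :
    (volume : Measure (Space N × ℝ)).IsAddHaarMeasure :=
  inferInstanceAs ((volume : Measure (Space N)).prod (volume : Measure ℝ)).IsAddHaarMeasure

/-! ### Hölder's inequality and time averages -/

lemma integrable_inner_and_abs_integral_le {α V : Type*} [MeasurableSpace α] {μ : Measure α}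
    [NormedAddCommGroup V] [InnerProductSpace ℝ V] {p : ℝ} (hp : 1 < p) {F Ψ : α → V}
    (hF : MemLp F (ENNReal.ofReal (p / (p - 1))) μ) (hΨ : MemLp Ψ (ENNReal.ofReal p) μ) :
    Integrable (fun z => inner ℝ (F z) (Ψ z)) μ ∧
      ENNReal.ofReal |∫ z, inner ℝ (F z) (Ψ z) ∂μ| ≤
        eLpNorm F (ENNReal.ofReal (p / (p - 1))) μ * eLpNorm Ψ (ENNReal.ofReal p) μ := by
  have hconj : (p / (p - 1)).HolderConjugate p := (Real.HolderConjugate.conjExponent hp).symm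
  have : (ENNReal.ofReal (p / (p - 1))).HolderTriple (ENNReal.ofReal p) 1 := hconj.ennrealOfReal
  have h := eLpNorm_le_eLpNorm_mul_eLpNorm_of_nnnorm (p := ENNReal.ofReal (p / (p - 1)))
    (q := ENNReal.ofReal p) (r := 1) hF.1 hΨ.1
    (fun x y => inner ℝ x y) 1 (Eventually.of_forall fun z => by
      rw [one_mul]; exact nnnorm_inner_le_nnnorm _ _)
  rw [ENNReal.coe_one, one_mul] at h
  have hm : AEStronglyMeasurable (fun z => inner ℝ (F z) (Ψ z)) μ := hF.1.inner hΨ.1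
  refine ⟨memLp_one_iff_integrable.1 ⟨hm, h.trans_lt (ENNReal.mul_lt_top hF.2 hΨ.2)⟩, ?_⟩
  refine le_trans ?_ h
  rw [eLpNorm_one_eq_lintegral_enorm, ← Real.enorm_eq_ofReal_abs]
  exact enorm_integral_le_lintegral_enorm _

lemma MemLp.ae_slice {X Y V : Type*} [MeasurableSpace X] [MeasurableSpace Y] {μ : Measure X}
    {ν : Measure Y} [SFinite μ] [SFinite ν] [NormedAddCommGroup V] {q : ℝ} (hq : 0 < q)
    {f : X × Y → V} (hf : MemLp f (ENNReal.ofReal q) (μ.prod ν)) :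
    ∀ᵐ y ∂ν, MemLp (fun x => f (x, y)) (ENNReal.ofReal q) μ := by
  have hq0 : ENNReal.ofReal q ≠ 0 := by simpa using hq
  have h1 := (hf.integrable_norm_rpow hq0 ENNReal.ofReal_ne_top).prod_left_ae
  filter_upwards [h1, hf.1.prod_swap.prodMk_left] with y h2 h3
  exact (integrable_norm_rpow_iff h3 hq0 ENNReal.ofReal_ne_top).1 h2

/-- If `Ψ(·, t)` satisfies, for almost every `t` and all small `h`, an inequality that involves the
averages of `F` over `(t - h, t)`, then it satisfies the corresponding inequality for `F` itself. -/
lemma neg_integral_inner_le_of_backward {p a t₁ t₂ B : ℝ} (hp : 1 < p) (ha : a < t₁)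
    (ht : t₁ < t₂) {E : Set (Space N)} (hE : MeasurableSet E) {F Ψ : Space N × ℝ → Space N}
    (hF : MemLp F (ENNReal.ofReal (p / (p - 1))) (volume.restrict (E ×ˢ Ioo a t₂)))
    (hΨ : MemLp Ψ (ENNReal.ofReal p) (volume.restrict (E ×ˢ Ioo t₁ t₂)))
    {Γ : ℝ → ℝ} (hΓ : ContinuousOn Γ (Icc a t₂)) (hΓ0 : ∀ t ∈ Icc a t₂, 0 ≤ Γ t)
    (hΓB : ∀ t ∈ Icc t₁ t₂, Γ t ≤ B)
    (hback : ∀ᵐ t ∂(volume.restrict (Ioo t₁ t₂)), ∀ h : ℝ, 0 < h → h < t₁ - a →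
      -∫ z in E ×ˢ Ioo (t - h) t, inner ℝ (F z) (Ψ (z.1, t)) ≤ Γ t - Γ (t - h)) :
    -∫ z in E ×ˢ Ioo t₁ t₂, inner ℝ (F z) (Ψ z) ≤ B := by
  set p' := ENNReal.ofReal (p / (p - 1)) with hp'
  have hp'1 : 1 ≤ p' := by
    rw [hp', ENNReal.one_le_ofReal, le_div_iff₀ (by linarith)]; linarith
  have hSa : MeasurableSet (E ×ˢ Ioo a t₂) := hE.prod measurableSet_Ioo
  have hS1 : MeasurableSet (E ×ˢ Ioo t₁ t₂) := hE.prod measurableSet_Ioo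
  set F' := (E ×ˢ Ioo a t₂).indicator F with hF'
  set Ψ' := (E ×ˢ Ioo t₁ t₂).indicator Ψ with hΨ'
  have hF'L : MemLp F' p' volume := (memLp_indicator_iff_restrict hSa).2 hF
  have hΨ'L : MemLp Ψ' (ENNReal.ofReal p) volume := (memLp_indicator_iff_restrict hS1).2 hΨ
  have hshift : ∀ s : ℝ, MeasurePreserving (fun z : Space N × ℝ => z - (0, s)) volume volume :=
    fun s => measurePreserving_sub_right volume _
  have hFs : ∀ s : ℝ, MemLp (fun z : Space N × ℝ => F' (z - (0, s))) p' volume := fun s =>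
    hF'L.comp_measurePreserving (hshift s)
  -- Pairing of the flux shifted by `s` in time with the unshifted test gradient. The claim concerns
  -- `c 0`, the hypothesis only means of `c` over `(0, h)`, and `c` is continuous at `0` by
  -- translation continuity.
  set c : ℝ → ℝ := fun s => ∫ z : Space N × ℝ, inner ℝ (F' (z - (0, s))) (Ψ' z) with hc
  have hc0 : c 0 = ∫ z in E ×ˢ Ioo t₁ t₂, inner ℝ (F z) (Ψ z) := by
    rw [← integral_indicator hS1]
    simp only [hc]
    congr 1; ext z
    have h0 : z - ((0 : Space N), (0 : ℝ)) = z := sub_zero z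
    rw [h0]
    by_cases hz : z ∈ E ×ˢ Ioo t₁ t₂
    · have hz' : z ∈ E ×ˢ Ioo a t₂ := ⟨hz.1, ha.trans hz.2.1, hz.2.2⟩
      rw [indicator_of_mem hz, hΨ', indicator_of_mem hz, hF', indicator_of_mem hz']
    · rw [indicator_of_notMem hz, hΨ', indicator_of_notMem hz, inner_zero_right]
  have hcont : Tendsto c (𝓝 0) (𝓝 (c 0)) := by
    have h1 := (tendsto_eLpNorm_translate_sub (μ := (volume : Measure (Space N × ℝ))) hp'1
      ENNReal.ofReal_ne_top hF'L).comp (f := fun s : ℝ => ((0 : Space N), s)) (x := 𝓝 0)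
      (by
        have : Continuous fun s : ℝ => ((0 : Space N), s) := by fun_prop
        exact this.tendsto 0)
    have h2 := ENNReal.Tendsto.mul_const (b := eLpNorm Ψ' (ENNReal.ofReal p) volume) h1
      (Or.inr hΨ'L.2.ne)
    rw [zero_mul] at h2
    rw [tendsto_iff_edist_tendsto_0]
    refine tendsto_of_tendsto_of_tendsto_of_le_of_le tendsto_const_nhds h2
      (fun _ => zero_le) fun s => ?_
    have h3 : c s - c 0 = ∫ z, inner ℝ (F' (z - (0, s)) - F' z) (Ψ' z) := by
      simp only [inner_sub_left]
      rw [integral_sub]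
      · simp only [hc]
        congr 2; ext z
        have h0 : z - ((0 : Space N), (0 : ℝ)) = z := sub_zero z
        rw [h0]
      · exact (integrable_inner_and_abs_integral_le hp (hFs s) hΨ'L).1
      · exact (integrable_inner_and_abs_integral_le hp hF'L hΨ'L).1
    rw [edist_dist, Real.dist_eq, h3]
    exact (integrable_inner_and_abs_integral_le hp ((hFs s).sub hF'L) hΨ'L).2
  -- the averaged inequality
  have havg : ∀ h : ℝ, 0 < h → h < t₁ - a → h < t₂ - t₁ →
      IntegrableOn c (Ioo 0 h) ∧ -(h * B) ≤ ∫ s in Ioo 0 h, c s := by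
    intro h h0 ha' hb'
    set m := (volume : Measure ℝ).restrict (Ioo 0 h) with hm
    have hmf : IsFiniteMeasure m := isFiniteMeasure_restrict.2 (by simp)
    -- The shear preserves measure, so the shifted flux is jointly in `L^{p'}` in the shift and the
    -- space-time point. This justifies Fubini.
    have hshear : MeasurePreserving (fun q : ℝ × (Space N × ℝ) => (q.1, q.2 - (0, q.1)))
        (m.prod volume) (m.prod volume) := by
      refine (MeasurePreserving.id m).skew_product (g := fun s z => z - (0, s)) ?_ ?_
      · have : Continuous (Function.uncurry fun (s : ℝ) (z : Space N × ℝ) =>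
            z - ((0 : Space N), s)) := by
          unfold Function.uncurry; fun_prop
        exact this.measurable
      · exact Eventually.of_forall fun s => (hshift s).map_eq
    have hΘF : MemLp (fun q : ℝ × (Space N × ℝ) => F' (q.2 - (0, q.1))) p' (m.prod volume) :=
      (hF'L.comp_snd m).comp_measurePreserving hshear
    have hΘ := (integrable_inner_and_abs_integral_le hp hΘF (hΨ'L.comp_snd m)).1
    have e1 : ∫ s in Ioo 0 h, c s = ∫ z : Space N × ℝ, ∫ s in Ioo 0 h,
        inner ℝ (F' (z - (0, s))) (Ψ' z) := by
      rw [← integral_prod_symm _ hΘ, integral_prod _ hΘ]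
    refine ⟨hΘ.integral_prod_left, ?_⟩
    have hk : Integrable (fun z : Space N × ℝ => ∫ s in Ioo 0 h,
        inner ℝ (F' (z - (0, s))) (Ψ' z)) volume := hΘ.integral_prod_right
    have e2 : ∫ s in Ioo 0 h, c s = ∫ t, ∫ x, ∫ s in Ioo 0 h,
        inner ℝ (F' ((x, t) - (0, s))) (Ψ' (x, t)) := by
      rw [e1, Measure.volume_eq_prod, integral_prod_symm _ hk]
    have e3 : ∀ t, t ∉ Ioo t₁ t₂ → ∫ x, ∫ s in Ioo 0 h,
        inner ℝ (F' ((x, t) - (0, s))) (Ψ' (x, t)) = 0 := by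
      intro t ht
      have : ∀ x, Ψ' (x, t) = 0 := fun x => indicator_of_notMem (fun hx => ht hx.2) _
      simp [this]
    rw [← setIntegral_eq_integral_of_forall_compl_eq_zero e3] at e2
    have hslice : ∀ᵐ t ∂(volume.restrict (Ioo t₁ t₂)),
        MemLp (fun x => Ψ (x, t)) (ENNReal.ofReal p) (volume.restrict E) := by
      apply MemLp.ae_slice (by linarith : (0 : ℝ) < p)
      rwa [Measure.prod_restrict, ← Measure.volume_eq_prod]
    have e4 : ∀ᵐ t ∂(volume.restrict (Ioo t₁ t₂)), ∫ x, ∫ s in Ioo 0 h,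
        inner ℝ (F' ((x, t) - (0, s))) (Ψ' (x, t)) =
        ∫ z in E ×ˢ Ioo (t - h) t, inner ℝ (F z) (Ψ (z.1, t)) := by
      filter_upwards [hslice, ae_restrict_mem measurableSet_Ioo] with t hst htm
      have hsubs : E ×ˢ Ioo (t - h) t ⊆ E ×ˢ Ioo a t₂ :=
        prod_mono le_rfl (Ioo_subset_Ioo (by linarith [htm.1]) htm.2.le)
      have hint : IntegrableOn (fun z : Space N × ℝ => inner ℝ (F z) (Ψ (z.1, t)))
          (E ×ˢ Ioo (t - h) t) := by
        have hf : IsFiniteMeasure ((volume : Measure ℝ).restrict (Ioo (t - h) t)) :=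
          isFiniteMeasure_restrict.2 (by simp)
        have h5 := hst.comp_fst ((volume : Measure ℝ).restrict (Ioo (t - h) t))
        rw [Measure.prod_restrict, ← Measure.volume_eq_prod] at h5
        exact (integrable_inner_and_abs_integral_le hp
          (hF.mono_measure (Measure.restrict_mono hsubs le_rfl)) h5).1
      rw [Measure.volume_eq_prod] at hint ⊢
      rw [setIntegral_prod _ hint, ← integral_indicator hE]
      congr 1; ext x
      by_cases hx : x ∈ E
      · have e5 : Ψ' (x, t) = Ψ (x, t) := indicator_of_mem (show (x, t) ∈ E ×ˢ Ioo t₁ t₂ from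
          ⟨hx, htm⟩) _
        rw [indicator_of_mem hx, e5]
        have e6 : ∫ s in Ioo 0 h, inner ℝ (F' ((x, t) - (0, s))) (Ψ (x, t)) =
            ∫ s in Ioo 0 h, inner ℝ (F (x, t - s)) (Ψ (x, t)) := by
          refine setIntegral_congr_fun measurableSet_Ioo fun s hs => ?_
          have e7 : ((x, t) - ((0 : Space N), s)) = (x, t - s) := by simp
          have e8 : (x, t - s) ∈ E ×ˢ Ioo a t₂ :=
            ⟨hx, by linarith [htm.1, hs.2], by linarith [htm.2, hs.1]⟩
          simp only [e7, hF', indicator_of_mem e8]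
        rw [e6, ← integral_Ioc_eq_integral_Ioo, ← integral_Ioc_eq_integral_Ioo,
          ← intervalIntegral.integral_of_le h0.le, ← intervalIntegral.integral_of_le (by linarith),
          intervalIntegral.integral_comp_sub_left (fun τ => inner ℝ (F (x, τ)) (Ψ (x, t))) t,
          sub_zero]
      · have e5 : Ψ' (x, t) = 0 := indicator_of_notMem (fun h => hx h.1) _
        rw [indicator_of_notMem hx, e5]
        simp
    have hΓi : ∀ x y, a ≤ x → x ≤ y → y ≤ t₂ → IntervalIntegrable Γ volume x y :=
      fun x y hx hxy hy => (hΓ.mono (by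
        rw [uIcc_of_le hxy]; exact Icc_subset_Icc hx hy)).intervalIntegrable
    have hΓs : IntervalIntegrable (fun t => Γ (t - h)) volume t₁ t₂ := by
      have := (hΓi (t₁ - h) (t₂ - h) (by linarith) (by linarith) (by linarith)).comp_sub_right h
      simpa using this
    have h6 : -∫ s in Ioo 0 h, c s ≤ ∫ t in t₁..t₂, (Γ t - Γ (t - h)) := by
      rw [e2, ← integral_neg, intervalIntegral.integral_of_le ht.le, integral_Ioc_eq_integral_Ioo]
      refine integral_mono_ae ?_ ?_ ?_
      · have h7 : Integrable (fun t => ∫ x, ∫ s in Ioo 0 h,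
          inner ℝ (F' ((x, t) - (0, s))) (Ψ' (x, t))) volume := hk.integral_prod_right
        exact h7.neg.restrict
      · exact ((hΓi t₁ t₂ ha.le ht.le le_rfl).sub hΓs).1.mono_set Ioo_subset_Ioc_self
      · filter_upwards [e4, hback] with t h8 h9
        simp only [h8]
        exact h9 h h0 ha'
    -- The integral telescopes to that of `Γ` over `(t₂ - h, t₂)` minus that over `(t₁ - h, t₁)`.
    -- The latter is nonnegative and is dropped.
    have h7 : ∫ t in t₁..t₂, (Γ t - Γ (t - h)) ≤ h * B := by
      rw [intervalIntegral.integral_sub (hΓi t₁ t₂ ha.le ht.le le_rfl) hΓs,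
        intervalIntegral.integral_comp_sub_right]
      have i1 := hΓi (t₁ - h) t₁ (by linarith) (by linarith) ht.le
      have i2 := hΓi t₁ t₂ ha.le ht.le le_rfl
      have i3 := hΓi (t₁ - h) (t₂ - h) (by linarith) (by linarith) (by linarith)
      rw [intervalIntegral.integral_interval_sub_interval_comm' i2 i3 i1.symm]
      have h9 : 0 ≤ ∫ t in (t₁ - h)..t₁, Γ t :=
        intervalIntegral.integral_nonneg (by linarith) fun t ht' =>
          hΓ0 t ⟨by linarith [ht'.1], by linarith [ht'.2]⟩
      have h10 : ∫ t in (t₂ - h)..t₂, Γ t ≤ ∫ _ in (t₂ - h)..t₂, B :=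
        intervalIntegral.integral_mono_on (by linarith)
          (hΓi _ _ (by linarith) (by linarith) le_rfl) (by simp)
          fun t ht' => hΓB t ⟨by linarith [ht'.1], ht'.2⟩
      rw [intervalIntegral.integral_const, sub_sub_cancel, smul_eq_mul] at h10
      linarith
    linarith
  by_contra hcon
  push Not at hcon
  rw [← hc0] at hcon
  -- If the claim fails, `(c 0 - B)/2` is the midpoint between `c 0` and `-B`. Staying below it for
  -- small shifts contradicts the lower bound `-B` for the means.
  obtain ⟨δ, hδ, hball⟩ := Metric.eventually_nhds_iff.1
    (hcont.eventually (gt_mem_nhds (show c 0 < (c 0 - B) / 2 by linarith)))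
  obtain ⟨h, h0, hlt⟩ := exists_between
    (lt_min hδ (lt_min (sub_pos.2 ha) (sub_pos.2 ht)))
  obtain ⟨hh1, hh2, hh3⟩ : h < δ ∧ h < t₁ - a ∧ h < t₂ - t₁ := by simpa using hlt
  obtain ⟨hi, hle⟩ := havg h h0 hh2 hh3
  have h1 : ∫ s in Ioo 0 h, c s ≤ ∫ s in Ioo 0 h, (c 0 - B) / 2 := by
    refine setIntegral_mono_on hi (by simp) measurableSet_Ioo fun s hs => ?_
    exact (hball (by rw [Real.dist_eq, sub_zero, abs_of_pos hs.1]; linarith [hs.2])).le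
  have h2 : ∫ s in Ioo 0 h, (c 0 - B) / 2 = h * ((c 0 - B) / 2) := by
    simp [h0.le]
  rw [h2] at h1
  nlinarith

/-! ### Consequences of the weak formulation -/

lemma MemW0.congr {E : Set (Space N)} (hE : MeasurableSet E) {p : ℝ} {f f' : Space N → ℝ}
    {g g' : Space N → Space N} (h : MemW0 E p f g) (hf : ∀ x ∈ E, f x = f' x)
    (hg : ∀ x ∈ E, g x = g' x) : MemW0 E p f' g' := by
  obtain ⟨φ, h1, h2, h3⟩ := h
  refine ⟨φ, h1, h2.congr fun n => ?_, h3.congr fun n => ?_⟩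
  · refine eLpNorm_congr_ae ?_
    filter_upwards [ae_restrict_mem hE] with x hx
    rw [hf x hx]
  · refine eLpNorm_congr_ae ?_
    filter_upwards [ae_restrict_mem hE] with x hx
    rw [hg x hx]

lemma memW0_of_contDiff {E : Set (Space N)} {p : ℝ} {η : Space N → ℝ} (hη : ContDiff ℝ ∞ η)
    (hηc : HasCompactSupport η) (hηs : tsupport η ⊆ interior E) :
    MemW0 E p η (gradient η) :=
  ⟨fun _ => η, fun _ => ⟨hη, hηc, hηs⟩, by simp, by simp⟩

lemma continuous_gradient {η : Space N → ℝ} (hη : ContDiff ℝ ∞ η) : Continuous (gradient η) :=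
  (LinearIsometryEquiv.continuous _).comp (hη.continuous_fderiv (by simp))

section solution
variable {Ω : Set (Space N)} {T m p K₁ K₂ : ℝ} {A : Space N → ℝ → ℝ → Space N → Space N}
  {u : Space N → ℝ → ℝ} {G : Space N → ℝ → Space N}

/-- The weak formulation with a test function that does not depend on time. -/
lemma IsLocalWeakSolutionWith.integral_sub_eq (hu : IsLocalWeakSolutionWith Ω T m p A u G)
    {E : Set (Space N)} (hE : IsCompact E) (hEΩ : E ⊆ Ω) {t₁ t₂ : ℝ} (h1 : 0 < t₁)
    (h12 : t₁ < t₂) (h2 : t₂ < T) {ψ : Space N → ℝ} {Dψ : Space N → Space N}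
    (hψ0 : ∀ x, 0 ≤ ψ x) (hψm : AEStronglyMeasurable ψ (volume.restrict E)) {C : ℝ}
    (hψC : ∀ x, ψ x ≤ C) (hDψ : MemLp Dψ (ENNReal.ofReal p) (volume.restrict E))
    (hW : MemW0 E p ψ Dψ) :
    (∫ x in E, u x t₂ * ψ x) - ∫ x in E, u x t₁ * ψ x =
      -∫ z in E ×ˢ Ioo t₁ t₂, inner ℝ (flux A m z.1 z.2 (u z.1 z.2) (G z.1 z.2)) (Dψ z.1) := by
  have hEf : IsFiniteMeasure (volume.restrict E) := isFiniteMeasure_restrict.2 hE.measure_lt_top.ne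
  have hTf : IsFiniteMeasure ((volume : Measure ℝ).restrict (Ioo 0 T)) :=
    isFiniteMeasure_restrict.2 (by simp)
  have hψL : ∀ q, MemLp (fun z : Space N × ℝ => ψ z.1) q (volume.restrict (E ×ˢ Ioo 0 T)) := by
    intro q
    have h3 : MemLp ψ q (volume.restrict E) := MemLp.of_bound hψm C
      (Eventually.of_forall fun x => by rw [Real.norm_of_nonneg (hψ0 x)]; exact hψC x)
    have h4 := h3.comp_fst ((volume : Measure ℝ).restrict (Ioo 0 T))
    rwa [Measure.prod_restrict, ← Measure.volume_eq_prod] at h4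
  have htest : IsTestFunction E T m p (fun x _ => ψ x) (fun _ _ => 0) (fun x _ => Dψ x) := by
    refine ⟨fun x _ => hψ0 x, hψL _, MemLp.zero, ?_, hψL _, ?_, ?_⟩
    · intro s₁ s₂ _ _ _
      simp
    · have h4 := hDψ.comp_fst ((volume : Measure ℝ).restrict (Ioo 0 T))
      rwa [Measure.prod_restrict, ← Measure.volume_eq_prod] at h4
    · exact Eventually.of_forall fun _ => hW
  have h3 := hu.weak_eq E hE hEΩ t₁ t₂ h1 h12 h2 _ _ _ htest
  simp only [mul_zero, neg_zero, zero_add] at h3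
  linarith

lemma IsLocalWeakSolutionWith.integrableOn_slice (hu : IsLocalWeakSolutionWith Ω T m p A u G)
    (hm : 0 < m) {E : Set (Space N)} (hE : IsCompact E) (hEΩ : E ⊆ Ω) {t : ℝ}
    (ht : t ∈ Ioo 0 T) : IntegrableOn (fun x => u x t) E := by
  have hEf : IsFiniteMeasure (volume.restrict E) := isFiniteMeasure_restrict.2 hE.measure_lt_top.ne
  refine (hu.memLp_slice E hE hEΩ t ht).integrable ?_
  rw [ENNReal.one_le_ofReal]
  linarith [mMinus_pos hm]

lemma IsLocalWeakSolutionWith.integrableOn_comp_mul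
    (hu : IsLocalWeakSolutionWith Ω T m p A u G)
    (hm : 0 < m) {E : Set (Space N)} (hE : IsCompact E) (hEΩ : E ⊆ Ω) {g : ℝ → ℝ} {L : ℝ}
    (hgc : Continuous g) (hg : ∀ a b, |g a - g b| ≤ L * |a - b|)
    {η : Space N → ℝ} (hη : Continuous η) (hη0 : ∀ x, 0 ≤ η x) (hη1 : ∀ x, η x ≤ 1) {t : ℝ}
    (ht : t ∈ Ioo 0 T) : IntegrableOn (fun x => g (u x t) * η x) E := by
  have hEf : IsFiniteMeasure (volume.restrict E) := isFiniteMeasure_restrict.2 hE.measure_lt_top.ne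
  have hi := hu.integrableOn_slice hm hE hEΩ ht
  refine Integrable.mono' ((integrable_const |g 0|).add (hi.norm.const_mul L))
    ((hgc.comp_aestronglyMeasurable hi.1).mul hη.aestronglyMeasurable)
    (Eventually.of_forall fun x => ?_)
  rw [norm_mul, Real.norm_of_nonneg (hη0 x), Real.norm_eq_abs]
  have h1 : |g (u x t)| ≤ |g 0| + L * |u x t| := by
    have h2 := hg (u x t) 0
    rw [sub_zero] at h2
    have h3 := abs_sub_abs_le_abs_sub (g (u x t)) (g 0)
    linarith
  calc |g (u x t)| * η x ≤ |g (u x t)| * 1 :=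
        mul_le_mul_of_nonneg_left (hη1 x) (abs_nonneg _)
    _ ≤ _ := by rw [mul_one]; exact h1

/-- On a set of finite measure, continuity in `L^{1+m⁻}` gives continuity in `L¹`, which a Lipschitz
`g` preserves. It makes `Γ` integrable in time and the supremum of the masses attained. -/
lemma IsLocalWeakSolutionWith.continuousOn_integral_comp_mul
    (hu : IsLocalWeakSolutionWith Ω T m p A u G)
    (hm : 0 < m) {E : Set (Space N)} (hE : IsCompact E) (hEΩ : E ⊆ Ω) {g : ℝ → ℝ} {L : ℝ}
    (hL : 0 ≤ L) (hgc : Continuous g) (hg : ∀ a b, |g a - g b| ≤ L * |a - b|)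
    {η : Space N → ℝ} (hη : Continuous η) (hη0 : ∀ x, 0 ≤ η x) (hη1 : ∀ x, η x ≤ 1) :
    ContinuousOn (fun t => ∫ x in E, g (u x t) * η x) (Ioo 0 T) := by
  have hEf : IsFiniteMeasure (volume.restrict E) := isFiniteMeasure_restrict.2 hE.measure_lt_top.ne
  intro t₀ ht₀
  refine ContinuousAt.continuousWithinAt ?_
  set q := ENNReal.ofReal (1 + mMinus m) with hq
  have hq1 : 1 ≤ q := by rw [hq, ENNReal.one_le_ofReal]; linarith [mMinus_pos hm]
  set c : ℝ≥0∞ := volume.restrict E univ ^ (1 / (1 : ℝ≥0∞).toReal - 1 / q.toReal) with hc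
  have hcf : c ≠ ⊤ := by
    refine ENNReal.rpow_ne_top_of_nonneg ?_ (measure_ne_top _ _)
    have : 1 ≤ q.toReal := by
      simpa using ENNReal.toReal_mono (b := q) ENNReal.ofReal_ne_top hq1
    rw [ENNReal.toReal_one, div_one, sub_nonneg, div_le_one (by linarith)]
    exact this
  have h1 := hu.continuous_time E hE hEΩ t₀ ht₀
  have h2 := ENNReal.Tendsto.const_mul (a := ENNReal.ofReal L)
    (ENNReal.Tendsto.mul_const (b := c) h1 (Or.inr hcf)) (Or.inr ENNReal.ofReal_ne_top)
  rw [zero_mul, mul_zero] at h2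
  rw [ContinuousAt, tendsto_iff_edist_tendsto_0]
  refine tendsto_of_tendsto_of_tendsto_of_le_of_le' tendsto_const_nhds h2
    (Eventually.of_forall fun _ => zero_le) ?_
  filter_upwards [isOpen_Ioo.mem_nhds ht₀] with t ht
  have hi := hu.integrableOn_comp_mul hm hE hEΩ hgc hg hη hη0 hη1 ht
  have hi₀ := hu.integrableOn_comp_mul hm hE hEΩ hgc hg hη hη0 hη1 ht₀
  have hd : AEStronglyMeasurable (fun x => u x t - u x t₀) (volume.restrict E) :=
    (hu.integrableOn_slice hm hE hEΩ ht).1.sub (hu.integrableOn_slice hm hE hEΩ ht₀).1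
  rw [edist_dist, Real.dist_eq, ← integral_sub hi hi₀, ← Real.enorm_eq_ofReal_abs]
  calc ‖∫ x in E, (g (u x t) * η x - g (u x t₀) * η x)‖ₑ
      ≤ ∫⁻ x in E, ‖g (u x t) * η x - g (u x t₀) * η x‖ₑ := enorm_integral_le_lintegral_enorm _
    _ ≤ ∫⁻ x in E, ENNReal.ofReal L * ‖u x t - u x t₀‖ₑ := by
        refine lintegral_mono fun x => ?_
        rw [← sub_mul, ← Real.enorm_of_nonneg hL, ← enorm_mul]
        apply enorm_le_iff_norm_le.2
        rw [norm_mul, Real.norm_of_nonneg (hη0 x), norm_mul, Real.norm_of_nonneg hL]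
        calc ‖g (u x t) - g (u x t₀)‖ * η x ≤ ‖g (u x t) - g (u x t₀)‖ * 1 :=
              mul_le_mul_of_nonneg_left (hη1 x) (norm_nonneg _)
          _ ≤ L * ‖u x t - u x t₀‖ := by rw [mul_one]; exact hg _ _
    _ = ENNReal.ofReal L * eLpNorm (fun x => u x t - u x t₀) 1 (volume.restrict E) := by
        rw [lintegral_const_mul' _ _ ENNReal.ofReal_ne_top, eLpNorm_one_eq_lintegral_enorm]
    _ ≤ _ := by
        gcongr
        exact eLpNorm_le_eLpNorm_mul_rpow_measure_univ hq1 hd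

/-! ### The frozen test function and its energy inequality -/

/-- The spatial gradient of `η (u^μ + ε)^{-b}`, at a point where `u = v` and `D u^μ = w`. -/
def testGradient (μ ε b : ℝ) (η : Space N → ℝ) (x : Space N) (v : ℝ) (w : Space N) : Space N :=
  profile μ ε b v • gradient η x + (η x * (-b * (max v 0 ^ μ + ε) ^ (-b - 1))) • w

lemma aestronglyMeasurable_testGradient {α : Type*} [MeasurableSpace α] {ν : Measure α}
    {μ ε b : ℝ} (hμ : 0 < μ) (hε : 0 < ε) {η : Space N → ℝ} (hη : ContDiff ℝ ∞ η)
    {X : α → Space N} (hX : AEMeasurable X ν) {v : α → ℝ} (hv : AEMeasurable v ν)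
    {w : α → Space N} (hw : AEStronglyMeasurable w ν) :
    AEStronglyMeasurable (fun a => testGradient μ ε b η (X a) (v a) (w a)) ν := by
  have h1 : AEStronglyMeasurable (fun a => profile μ ε b (v a)) ν :=
    ((profile_continuous hμ hε).measurable.comp_aemeasurable hv).aestronglyMeasurable
  have h2 : AEStronglyMeasurable (fun a => gradient η (X a)) ν :=
    ((continuous_gradient hη).measurable.comp_aemeasurable hX).aestronglyMeasurable
  have h3 : AEStronglyMeasurable (fun a => η (X a)) ν :=
    (hη.continuous.measurable.comp_aemeasurable hX).aestronglyMeasurable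
  have h4 : AEStronglyMeasurable (fun a => -b * (max (v a) 0 ^ μ + ε) ^ (-b - 1)) ν :=
    (((((hv.max aemeasurable_const).pow_const μ).add_const ε).pow_const
      (-b - 1)).const_mul (-b)).aestronglyMeasurable
  exact (h1.smul h2).add ((h3.mul h4).smul hw)

lemma norm_testGradient_le {μ ε b : ℝ} (hε : 0 < ε) (hb : 0 < b)
    {η : Space N → ℝ} (hη0 : ∀ x, 0 ≤ η x) (hη1 : ∀ x, η x ≤ 1) {C : ℝ}
    (hC : ∀ x, ‖gradient η x‖ ≤ C) (x : Space N) (v : ℝ) (w : Space N) :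
    ‖testGradient μ ε b η x v w‖ ≤ ε ^ (-b) * C + b * ε ^ (-b - 1) * ‖w‖ := by
  have hz : 0 ≤ max v 0 ^ μ := by positivity
  refine (norm_add_le _ _).trans (add_le_add ?_ ?_)
  · rw [norm_smul, Real.norm_of_nonneg (profile_pos hε v).le]
    exact mul_le_mul (profile_le hε hb.le v) (hC x) (norm_nonneg _) (by positivity)
  · have h1 : 0 ≤ (max v 0 ^ μ + ε) ^ (-b - 1) := by positivity
    have h2 : (max v 0 ^ μ + ε) ^ (-b - 1) ≤ ε ^ (-b - 1) :=
      Real.rpow_le_rpow_of_nonpos hε (by linarith) (by linarith)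
    rw [norm_smul, norm_mul, norm_mul, norm_neg, Real.norm_of_nonneg (hη0 x),
      Real.norm_of_nonneg hb.le, Real.norm_of_nonneg h1]
    have h3 : η x * (b * (max v 0 ^ μ + ε) ^ (-b - 1)) ≤ 1 * (b * ε ^ (-b - 1)) := by
      apply mul_le_mul (hη1 x) _ (by positivity) zero_le_one
      gcongr
    rw [one_mul] at h3
    gcongr

lemma exists_bound_gradient {η : Space N → ℝ} (hη : ContDiff ℝ ∞ η) (hηc : HasCompactSupport η) :
    ∃ C, ∀ x, ‖gradient η x‖ ≤ C :=
  (continuous_gradient hη).bounded_above_of_compact_support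
    ((hηc.fderiv ℝ).comp_left (g := (InnerProductSpace.toDual ℝ (Space N)).symm) (by simp))

lemma prod_Icc_subset_spaceTime {E : Set (Space N)} (hEΩ : E ⊆ Ω) {t₁ t₂ : ℝ} (h1 : 0 < t₁)
    (h2 : t₂ < T) : E ×ˢ Icc t₁ t₂ ⊆ spaceTime Ω T :=
  Set.prod_mono hEΩ (Icc_subset_Ioo h1 h2)

lemma IsLocalWeakSolutionWith.memLp_testGradient (hu : IsLocalWeakSolutionWith Ω T m p A u G)
    {μ ε b : ℝ} (hμ : 0 < μ) (hε : 0 < ε) (hb : 0 < b) {E : Set (Space N)}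
    (hE : IsCompact E) (hEΩ : E ⊆ Ω) {t₁ t₂ : ℝ} (h1 : 0 < t₁) (h2 : t₂ < T)
    {η : Space N → ℝ} (hη : ContDiff ℝ ∞ η) (hηc : HasCompactSupport η) (hη0 : ∀ x, 0 ≤ η x)
    (hη1 : ∀ x, η x ≤ 1) :
    MemLp (fun z : Space N × ℝ => testGradient μ ε b η z.1 (u z.1 z.2) (G z.1 z.2))
      (ENNReal.ofReal p) (volume.restrict (E ×ˢ Icc t₁ t₂)) := by
  obtain ⟨C, hC⟩ := exists_bound_gradient hη hηc
  have hK : IsCompact (E ×ˢ Icc t₁ t₂) := hE.prod isCompact_Icc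
  have hKf : IsFiniteMeasure (volume.restrict (E ×ˢ Icc t₁ t₂)) :=
    isFiniteMeasure_restrict.2 hK.measure_lt_top.ne
  have hKΩ := prod_Icc_subset_spaceTime (T := T) hEΩ h1 h2
  have hG := hu.memLp_grad _ hK hKΩ
  have hum := (hu.locally_bounded _ hK hKΩ).1.aemeasurable
  have h3 : MemLp (fun z : Space N × ℝ => b * ε ^ (-b - 1) * ‖G z.1 z.2‖) (ENNReal.ofReal p)
      (volume.restrict (E ×ˢ Icc t₁ t₂)) := hG.norm.const_mul _
  have h4 : MemLp (fun _ : Space N × ℝ => ε ^ (-b) * C) (ENNReal.ofReal p)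
      (volume.restrict (E ×ˢ Icc t₁ t₂)) := memLp_const _
  refine (h4.add h3).mono
    (aestronglyMeasurable_testGradient hμ hε hη measurable_fst.aemeasurable hum hG.1)
    (Eventually.of_forall fun z => ?_)
  exact (norm_testGradient_le hε hb hη0 hη1 hC _ _ _).trans (le_abs_self _)

/-- The energy estimate obtained by testing with the negative power `η (u^{m⁻} + ε)^{-b}`. -/
lemma IsLocalWeakSolutionWith.neg_integral_flux_testGradient_le
    (hu : IsLocalWeakSolutionWith Ω T m p A u G) (hm : 0 < m) (hp : 1 < p) (hK₂ : 0 < K₂)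
    (hA : IsCaratheodory Ω T A) (hA' : StructureConditions Ω T m p K₁ K₂ A) {y : Space N}
    {R R' : ℝ} (hR : R < R') (hsub : closedBall y R' ⊆ Ω) {ε b : ℝ} (hε : 0 < ε) (hb : 0 < b)
    {η : Space N → ℝ} (hη : ContDiff ℝ ∞ η) (hη0 : ∀ x, 0 ≤ η x)
    (hη1 : ∀ x, η x ≤ 1) (hηs : tsupport η ⊆ ball y R) {t₁ t₂ B : ℝ} (h1 : 0 < t₁)
    (h12 : t₁ < t₂) (h2 : t₂ < T)
    (hB : ∀ t ∈ Icc t₁ t₂,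
      ∫ x in closedBall y R, profilePrimitive (mMinus m) ε b (u x t) * η x ≤ B) :
    -∫ z in closedBall y R ×ˢ Ioo t₁ t₂,
      inner ℝ (flux A m z.1 z.2 (u z.1 z.2) (G z.1 z.2))
        (testGradient (mMinus m) ε b η z.1 (u z.1 z.2) (G z.1 z.2)) ≤ B := by
  set μ := mMinus m with hμdef
  have hμ : 0 < μ := mMinus_pos hm
  set E := closedBall y R with hE
  set E' := closedBall y R' with hE'
  have hEE' : E ⊆ E' := closedBall_subset_closedBall hR.le
  have hEΩ : E ⊆ Ω := hEE'.trans hsub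
  have hEc : IsCompact E := isCompact_closedBall y R
  have hEm : MeasurableSet E := hEc.measurableSet
  have hE'c : IsCompact E' := isCompact_closedBall y R'
  have hηc : HasCompactSupport η := (isCompact_closedBall y R).of_isClosed_subset
    (isClosed_tsupport _) (hηs.trans ball_subset_closedBall)
  have hLip := abs_profilePrimitive_sub_le (b := b) hμ hε hb.le
  have hPc : Continuous (profilePrimitive μ ε b) := profilePrimitive_continuous hμ hε
  -- Starting at `t₁ / 2` leaves room for backward differences of length `h` before `t₁`.
  have ha0 : 0 < t₁ / 2 := by positivity
  have hΓc := (hu.continuousOn_integral_comp_mul hm hEc hEΩ (by positivity) hPc hLip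
    hη.continuous hη0 hη1).mono (Icc_subset_Ioo ha0 h2)
  have hF := flux_memLp hm hp hK₂ hA hA' hu (hEc.prod isCompact_Icc)
    (prod_Icc_subset_spaceTime hEΩ ha0 h2)
  have hΨ := hu.memLp_testGradient (ε := ε) (b := b) hμ hε hb hEc hEΩ h1 h2 hη hηc hη0 hη1
  refine neg_integral_inner_le_of_backward hp (half_lt_self h1) h12 hEm
    (hF.mono_measure (Measure.restrict_mono (Set.prod_mono le_rfl Ioo_subset_Icc_self) le_rfl))
    (hΨ.mono_measure (Measure.restrict_mono (Set.prod_mono le_rfl Ioo_subset_Icc_self) le_rfl))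
    (Γ := fun t => ∫ x in E, profilePrimitive μ ε b (u x t) * η x) hΓc ?_ hB ?_
  · intro t ht
    refine setIntegral_nonneg hEm fun x hx => mul_nonneg (profilePrimitive_nonneg hε ?_) (hη0 x)
    exact hu.nonneg x (hEΩ hx) t (Icc_subset_Ioo ha0 h2 ht)
  · have hK'Ω := prod_Icc_subset_spaceTime (T := T) hsub h1 h2
    have hK'c : IsCompact (E' ×ˢ Icc t₁ t₂) := hE'c.prod isCompact_Icc
    have hws := hu.memLp_pow _ hK'c hK'Ω
    have hGs := hu.memLp_grad _ hK'c hK'Ω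
    rw [Measure.volume_eq_prod, ← Measure.prod_restrict] at hws hGs
    have hle : (volume : Measure ℝ).restrict (Ioo t₁ t₂) ≤ volume.restrict (Icc t₁ t₂) :=
      Measure.restrict_mono Ioo_subset_Icc_self le_rfl
    have hle' : (volume : Measure ℝ).restrict (Ioo t₁ t₂) ≤ volume.restrict (Ioo 0 T) :=
      Measure.restrict_mono (Ioo_subset_Ioo h1.le h2.le) le_rfl
    filter_upwards [ae_mono hle (MemLp.ae_slice (by linarith : (0 : ℝ) < p) hws),
      ae_mono hle (MemLp.ae_slice (by linarith : (0 : ℝ) < p) hGs),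
      ae_mono hle' hu.weakGradient, ae_restrict_mem measurableSet_Ioo] with t hwt hGt hwg ht h h0 hh
    have ht' : t ∈ Ioo 0 T := ⟨h1.trans ht.1, ht.2.trans h2⟩
    have hth : t - h ∈ Ioo 0 T := ⟨by linarith [ht.1], by linarith [ht.2]⟩
    have hnn : ∀ x ∈ Ω, 0 ≤ u x t := fun x hx => hu.nonneg x hx t ht'
    have hW := memW0_cutoff_mul_rpow hp hR hsub hwg
      (fun x hx => Real.rpow_nonneg (hnn x hx) _) hwt hGt hε hb hη hη0 hη1 hηs
    have hW' : MemW0 E p (fun x => η x * profile μ ε b (u x t))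
        (fun x => testGradient μ ε b η x (u x t) (G x t)) := by
      refine hW.congr hEm (fun x hx => ?_) (fun x hx => ?_)
      · rw [profile, max_eq_left (hnn x (hEΩ hx))]
      · rw [testGradient, profile, max_eq_left (hnn x (hEΩ hx))]
    have hut := hu.integrableOn_slice hm hEc hEΩ ht'
    have huth := hu.integrableOn_slice hm hEc hEΩ hth
    have hprofm : AEStronglyMeasurable (fun x => profile μ ε b (u x t)) (volume.restrict E) :=
      (profile_continuous hμ hε).comp_aestronglyMeasurable hut.1
    have hψm : AEStronglyMeasurable (fun x => η x * profile μ ε b (u x t))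
        (volume.restrict E) := hη.continuous.aestronglyMeasurable.mul hprofm
    have hψ0 : ∀ x, 0 ≤ η x * profile μ ε b (u x t) := fun x =>
      mul_nonneg (hη0 x) (profile_pos hε _).le
    have hψC : ∀ x, η x * profile μ ε b (u x t) ≤ ε ^ (-b) := fun x => by
      calc _ ≤ 1 * ε ^ (-b) := mul_le_mul (hη1 x) (profile_le hε hb.le _) (profile_pos hε _).le
            zero_le_one
        _ = _ := one_mul _
    have hEf : IsFiniteMeasure (volume.restrict E) :=
      isFiniteMeasure_restrict.2 hEc.measure_lt_top.ne
    have hGtE : MemLp (fun x => G x t) (ENNReal.ofReal p) (volume.restrict E) :=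
      hGt.mono_measure (Measure.restrict_mono hEE' le_rfl)
    have hDψ : MemLp (fun x => testGradient μ ε b η x (u x t) (G x t)) (ENNReal.ofReal p)
        (volume.restrict E) := by
      obtain ⟨C, hC⟩ := exists_bound_gradient hη hηc
      have h3 : MemLp (fun x => b * ε ^ (-b - 1) * ‖G x t‖) (ENNReal.ofReal p)
        (volume.restrict E) := hGtE.norm.const_mul _
      have h4 : MemLp (fun _ : Space N => ε ^ (-b) * C) (ENNReal.ofReal p)
        (volume.restrict E) := memLp_const _
      refine (h4.add h3).mono (aestronglyMeasurable_testGradient hμ hε hη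
        measurable_id.aemeasurable hut.1.aemeasurable hGtE.1) (Eventually.of_forall fun x => ?_)
      exact (norm_testGradient_le hε hb hη0 hη1 hC _ _ _).trans (le_abs_self _)
    -- The test function is frozen at the later time `t`. Its coefficient is thus the slope of the
    -- primitive at `u(·,t)`, the side on which concavity gives the needed sign.
    have hid := hu.integral_sub_eq hEc hEΩ hth.1 (by linarith : t - h < t) ht'.2 hψ0 hψm hψC
      hDψ hW'
    have hbdd : ∀ {f : Space N → ℝ}, IntegrableOn f E →
        IntegrableOn (fun x => f x * (η x * profile μ ε b (u x t))) E := by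
      intro f hf
      refine Integrable.mul_bdd (c := ε ^ (-b)) hf hψm (Eventually.of_forall fun x => ?_)
      rw [Real.norm_of_nonneg (hψ0 x)]
      exact hψC x
    have hi1 := hbdd hut
    have hi2 := hbdd huth
    have hi3 := hu.integrableOn_comp_mul hm hEc hEΩ hPc hLip hη.continuous hη0 hη1 ht'
    have hi4 := hu.integrableOn_comp_mul hm hEc hEΩ hPc hLip hη.continuous hη0 hη1 hth
    refine hid.symm.le.trans ?_
    rw [← integral_sub hi1 hi2, ← integral_sub hi3 hi4]
    refine integral_mono (hi1.sub hi2) (hi3.sub hi4) fun x => ?_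
    have h5 := sub_mul_profile_le hμ hε hb.le (u x t) (u x (t - h))
    have h6 := mul_le_mul_of_nonneg_right h5 (hη0 x)
    linarith

end solution

/-! ### The energy estimate -/

/-- The weighted energy density `η u^{(m-m⁻)(p-1)} |D u^{m⁻}|^p (u^{m⁻} + ν^{m⁻})^{-b-1}`. -/
def energyDensity (m p ν b : ℝ) (η : Space N → ℝ) (x : Space N) (v : ℝ) (w : Space N) : ℝ :=
  η x * (fluxWeight m p v * ‖w‖ ^ p) * (v ^ mMinus m + ν ^ mMinus m) ^ (-b - 1)

lemma energyDensity_nonneg {m p ν b : ℝ} (hν : 0 < ν) {η : Space N → ℝ} (hη0 : ∀ x, 0 ≤ η x)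
    (x : Space N) {v : ℝ} (hv : 0 ≤ v) (w : Space N) : 0 ≤ energyDensity m p ν b η x v w := by
  have := hη0 x
  have := fluxWeight_nonneg m p v
  unfold energyDensity
  positivity

lemma measurable_fluxWeight (m p : ℝ) : Measurable (fluxWeight m p) :=
  Measurable.ite measurableSet_Ioi (measurable_id.pow_const _) measurable_const

section solution
variable {Ω : Set (Space N)} {T m p K₁ K₂ : ℝ} {A : Space N → ℝ → ℝ → Space N → Space N}
  {u : Space N → ℝ → ℝ} {G : Space N → ℝ → Space N}

lemma IsLocalWeakSolutionWith.integrableOn_prod (hu : IsLocalWeakSolutionWith Ω T m p A u G)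
    {E : Set (Space N)} (hE : IsCompact E) (hEΩ : E ⊆ Ω) {t₁ t₂ : ℝ} (h1 : 0 < t₁)
    (h2 : t₂ < T) : IntegrableOn (fun z : Space N × ℝ => u z.1 z.2) (E ×ˢ Icc t₁ t₂) := by
  have hK : IsCompact (E ×ˢ Icc t₁ t₂) := hE.prod isCompact_Icc
  have hKf : IsFiniteMeasure (volume.restrict (E ×ˢ Icc t₁ t₂)) :=
    isFiniteMeasure_restrict.2 hK.measure_lt_top.ne
  exact (hu.locally_bounded _ hK (prod_Icc_subset_spaceTime hEΩ h1 h2)).integrable (by simp)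

/-- By the choice of `M`, the integral of `(u + ν) η` is at most `M V`, so each of the two terms
contributes at most `V M^c`. -/
lemma IsLocalWeakSolutionWith.integral_moment_le (hu : IsLocalWeakSolutionWith Ω T m p A u G)
    (hm : 0 < m) {E : Set (Space N)} (hE : IsCompact E) (hEΩ : E ⊆ Ω) {η : Space N → ℝ}
    (hη : Continuous η) (hη0 : ∀ x, 0 ≤ η x) (hη1 : ∀ x, η x ≤ 1) {V X ν M : ℝ}
    (hV : 0 < V) (hVE : volume.real E ≤ V) (hν : 0 < ν) (hM : M = X / V + ν) (hM0 : 0 < M)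
    {t : ℝ} (ht : t ∈ Ioo 0 T) (hX : ∫ x in E, u x t * η x ≤ X) (c : ℝ) :
    IntegrableOn (fun x => M ^ c + M ^ (c - 1) * ((u x t + ν) * η x)) E ∧
    ∫ x in E, (M ^ c + M ^ (c - 1) * ((u x t + ν) * η x)) ≤ 2 * V * M ^ c := by
  have hEf : IsFiniteMeasure (volume.restrict E) := isFiniteMeasure_restrict.2 hE.measure_lt_top.ne
  have hi1 : IntegrableOn (fun x => u x t * η x) E :=
    hu.integrableOn_comp_mul hm hE hEΩ (g := fun v => v) (L := 1) continuous_id (by simp)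
      hη hη0 hη1 ht
  have hi2 : IntegrableOn (fun x => ν * η x) E := (hη.const_mul ν).continuousOn.integrableOn_compact hE
  have hi3 : IntegrableOn (fun x => (u x t + ν) * η x) E := by
    simp only [add_mul]; exact hi1.add hi2
  have h4 : ∫ x in E, (u x t + ν) * η x ≤ M * V := by
    have e : ∫ x in E, (u x t + ν) * η x = (∫ x in E, u x t * η x) + ∫ x in E, ν * η x := by
      simp only [add_mul]; exact integral_add hi1 hi2
    have h5 : ∫ x in E, ν * η x ≤ ∫ x in E, ν := by
      refine integral_mono hi2 (integrable_const _) fun x => ?_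
      calc ν * η x ≤ ν * 1 := by gcongr; exact hη1 x
        _ = ν := mul_one ν
    rw [setIntegral_const, smul_eq_mul] at h5
    have h6 : volume.real E * ν ≤ V * ν := by gcongr
    have h7 : M * V = X + V * ν := by rw [hM]; field_simp
    linarith
  refine ⟨(integrable_const _).add (hi3.const_mul _), ?_⟩
  rw [integral_add (integrable_const _) (hi3.const_mul _), integral_const_mul, setIntegral_const,
    smul_eq_mul]
  have h8 : M ^ (c - 1) * M = M ^ c := by
    rw [← Real.rpow_add_one hM0.ne']; ring_nf
  have h9 : M ^ (c - 1) * ∫ x in E, (u x t + ν) * η x ≤ M ^ (c - 1) * (M * V) := by gcongr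
  have h10 : volume.real E * M ^ c ≤ V * M ^ c := by gcongr
  have h11 : M ^ (c - 1) * (M * V) = V * M ^ c := by rw [← h8]; ring
  linarith

lemma IsLocalWeakSolutionWith.setIntegral_moment_le (hu : IsLocalWeakSolutionWith Ω T m p A u G)
    (hm : 0 < m) {E : Set (Space N)} (hE : IsCompact E) (hEΩ : E ⊆ Ω) {η : Space N → ℝ}
    (hη : Continuous η) (hη0 : ∀ x, 0 ≤ η x) (hη1 : ∀ x, η x ≤ 1) {V X ν M t₁ t₂ : ℝ}
    (hV : 0 < V) (hVE : volume.real E ≤ V) (hν : 0 < ν) (hM : M = X / V + ν) (hM0 : 0 < M)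
    (h1 : 0 < t₁) (h12 : t₁ < t₂) (h2 : t₂ < T)
    (hX : ∀ t ∈ Icc t₁ t₂, ∫ x in E, u x t * η x ≤ X) (c : ℝ) :
    IntegrableOn (fun z : Space N × ℝ => M ^ c + M ^ (c - 1) * ((u z.1 z.2 + ν) * η z.1))
      (E ×ˢ Ioo t₁ t₂) ∧
    ∫ z in E ×ˢ Ioo t₁ t₂, (M ^ c + M ^ (c - 1) * ((u z.1 z.2 + ν) * η z.1)) ≤
      2 * V * (t₂ - t₁) * M ^ c := by
  have hui := (hu.integrableOn_prod hE hEΩ h1 h2).mono_set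
    (Set.prod_mono le_rfl (Ioo_subset_Icc_self (a := t₁) (b := t₂)))
  have hSf : IsFiniteMeasure (volume.restrict (E ×ˢ Ioo t₁ t₂)) := by
    refine isFiniteMeasure_restrict.2 (measure_mono (Set.prod_mono le_rfl
      (Ioo_subset_Icc_self (a := t₁) (b := t₂))) |>.trans_lt ?_).ne
    exact (hE.prod isCompact_Icc).measure_lt_top
  have hi1 : IntegrableOn (fun z : Space N × ℝ => (u z.1 z.2 + ν) * η z.1) (E ×ˢ Ioo t₁ t₂) := by
    refine Integrable.mul_bdd (c := 1) (hui.add (integrable_const _))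
      (hη.comp continuous_fst).aestronglyMeasurable (Eventually.of_forall fun z => ?_)
    change ‖η z.1‖ ≤ 1
    rw [Real.norm_of_nonneg (hη0 _)]
    exact hη1 _
  have hi2 : IntegrableOn (fun z : Space N × ℝ => M ^ c + M ^ (c - 1) * ((u z.1 z.2 + ν) * η z.1))
      (E ×ˢ Ioo t₁ t₂) := (integrable_const _).add (hi1.const_mul _)
  refine ⟨hi2, ?_⟩
  have hi3 := hi2
  rw [IntegrableOn, Measure.volume_eq_prod, ← Measure.prod_restrict] at hi3
  rw [Measure.volume_eq_prod, ← Measure.prod_restrict, integral_prod_symm _ hi3]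
  have h3 : ∫ t in Ioo t₁ t₂, ∫ x in E, (M ^ c + M ^ (c - 1) * ((u x t + ν) * η x)) ≤
      ∫ t in Ioo t₁ t₂, 2 * V * M ^ c := by
    refine setIntegral_mono_on hi3.integral_prod_right
      (continuous_const.integrableOn_Icc.mono_set Ioo_subset_Icc_self) measurableSet_Ioo
      fun t ht => ?_
    exact (hu.integral_moment_le hm hE hEΩ hη hη0 hη1 hV hVE hν hM hM0
      ⟨h1.trans ht.1, ht.2.trans h2⟩ (hX t (Ioo_subset_Icc_self ht)) c).2
  refine h3.trans (le_of_eq ?_)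
  rw [setIntegral_const, smul_eq_mul, Real.volume_real_Ioo_of_le h12.le]
  ring

/-- The weighted energy density is integrable, and it is controlled by a power of the supremum of
the spatial averages. -/
lemma IsLocalWeakSolutionWith.integral_energyDensity_le
    (hu : IsLocalWeakSolutionWith Ω T m p A u G) (hm : 0 < m) (hp : 1 < p) (hK₁ : 0 < K₁)
    (hK₂ : 0 < K₂)
    (hA : IsCaratheodory Ω T A) (hA' : StructureConditions Ω T m p K₁ K₂ A) {y : Space N}
    {R R' : ℝ} (hR : R < R') (hsub : closedBall y R' ⊆ Ω) {ν b δ r C : ℝ} (hν : 0 < ν) (hb : 0 < b)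
    (hbp : b ≤ p - 1) (hb1 : b ≤ 1 / 2) (hδ : δ < 1) (hδp : m * (p - 1) ≤ 1 - δ * p)
    (hlam : m * (p - 1) < 1) (hr : 0 < r) (hC : 0 < C)
    {η : Space N → ℝ} (hη : ContDiff ℝ ∞ η) (hη0 : ∀ x, 0 ≤ η x)
    (hη1 : ∀ x, η x ≤ 1) (hηs : tsupport η ⊆ ball y R)
    (hηg : ∀ x, ‖gradient η x‖ ≤ C * (η x ^ (1 - δ) / r)) {V X M t₁ t₂ : ℝ} (h1 : 0 < t₁)
    (h12 : t₁ < t₂) (h2 : t₂ < T) (hV : 0 < V) (hVE : volume.real (closedBall y R) ≤ V)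
    (hM : M = X / V + ν) (hX0 : 0 ≤ X)
    (hX : ∀ t ∈ Icc t₁ t₂, ∫ x in closedBall y R, u x t * η x ≤ X)
    (hH : (t₂ - t₁) / r ^ p ≤ ν ^ (1 - m * (p - 1))) :
    IntegrableOn (fun z : Space N × ℝ => energyDensity m p ν b η z.1 (u z.1 z.2) (G z.1 z.2))
      (closedBall y R ×ˢ Ioo t₁ t₂) ∧
    ∫ z in closedBall y R ×ˢ Ioo t₁ t₂, energyDensity m p ν b η z.1 (u z.1 z.2) (G z.1 z.2) ≤
      (4 + 2 * ((K₂ * C) ^ p * (b * K₁ / 2) ^ (1 - p) * 2 ^ (p - 1 - b))) / (b * K₁ / 2) * V *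
        M ^ (1 - b * mMinus m) := by
  set μ := mMinus m with hμdef
  have hμ : 0 < μ := mMinus_pos hm
  have hμ1 : μ ≤ 1 := mMinus_le_one m
  have hμm : μ ≤ m := mMinus_le m
  set E := closedBall y R with hE
  have hEΩ : E ⊆ Ω := (closedBall_subset_closedBall hR.le).trans hsub
  have hEc : IsCompact E := isCompact_closedBall y R
  have hEm : MeasurableSet E := hEc.measurableSet
  have hηc : HasCompactSupport η := (isCompact_closedBall y R).of_isClosed_subset
    (isClosed_tsupport _) (hηs.trans ball_subset_closedBall)
  have hM0 : 0 < M := by rw [hM]; positivity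
  have hνM : ν ≤ M := by rw [hM]; linarith [div_nonneg hX0 hV.le]
  have hε : 0 < ν ^ μ := by positivity
  have hbμ : b * μ ≤ 1 / 2 := by nlinarith
  have hbμ0 : 0 < b * μ := by positivity
  set S := E ×ˢ Ioo t₁ t₂ with hS
  have hSm : MeasurableSet S := hEm.prod measurableSet_Ioo
  have hSK : S ⊆ E ×ˢ Icc t₁ t₂ := Set.prod_mono le_rfl Ioo_subset_Icc_self
  have hKΩ := prod_Icc_subset_spaceTime (T := T) hEΩ h1 h2
  have hKc : IsCompact (E ×ˢ Icc t₁ t₂) := hEc.prod isCompact_Icc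
  have hSr : volume.restrict S ≤ volume.restrict (E ×ˢ Icc t₁ t₂) := Measure.restrict_mono hSK le_rfl
  have hF := (flux_memLp hm hp hK₂ hA hA' hu hKc hKΩ).mono_measure hSr
  have hG := (hu.memLp_grad _ hKc hKΩ).mono_measure hSr
  have hum := ((hu.locally_bounded _ hKc hKΩ).1.mono_measure hSr).aemeasurable
  have hΨ := (hu.memLp_testGradient (ε := ν ^ μ) (b := b) hμ hε hb hEc hEΩ h1 h2 hη hηc hη0
    hη1).mono_measure hSr
  have hFG := (integrable_inner_and_abs_integral_le hp hF hG).1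
  have hFΨ := (integrable_inner_and_abs_integral_le hp hF hΨ).1
  have hbds := ae_mono (Measure.restrict_mono (hSK.trans hKΩ) le_rfl : volume.restrict S ≤ _)
    (flux_bounds hm hA')
  have hu0 : ∀ z ∈ S, 0 ≤ u z.1 z.2 := fun z hz =>
    hu.nonneg _ (hEΩ hz.1) _ ⟨h1.trans hz.2.1, hz.2.2.trans h2⟩
  -- integrability of the density
  have hPm : AEStronglyMeasurable (fun z : Space N × ℝ =>
      energyDensity m p ν b η z.1 (u z.1 z.2) (G z.1 z.2)) (volume.restrict S) := by
    have e1 : AEStronglyMeasurable (fun z : Space N × ℝ => η z.1) (volume.restrict S) :=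
      (hη.continuous.comp continuous_fst).aestronglyMeasurable
    have e2 := ((measurable_fluxWeight m p).comp_aemeasurable hum).mul
      (hG.1.aemeasurable.norm.pow_const p)
    have e3 := ((hum.pow_const μ).add_const (ν ^ μ)).pow_const (-b - 1)
    exact ((e1.aemeasurable.mul e2).mul e3).aestronglyMeasurable
  have hPi : IntegrableOn (fun z : Space N × ℝ =>
      energyDensity m p ν b η z.1 (u z.1 z.2) (G z.1 z.2)) S := by
    -- Coercivity bounds the density by the product of flux and gradient, integrable by Hölder; the
    -- negative power is at most its value at `u = 0`.
    refine Integrable.mono' (hFG.const_mul ((ν ^ μ) ^ (-b - 1) / K₁)) hPm ?_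
    filter_upwards [hbds, ae_restrict_mem hSm] with z hz hzS
    have huz := hu0 z hzS
    rw [Real.norm_of_nonneg (energyDensity_nonneg hν hη0 _ huz _)]
    have e1 := (hz (u z.1 z.2) (G z.1 z.2)).2
    have e2 : (u z.1 z.2 ^ μ + ν ^ μ) ^ (-b - 1) ≤ (ν ^ μ) ^ (-b - 1) := by
      refine Real.rpow_le_rpow_of_nonpos hε ?_ (by linarith)
      have : 0 ≤ u z.1 z.2 ^ μ := by positivity
      linarith
    have e3 := fluxWeight_nonneg m p (u z.1 z.2)
    have e4 := hη0 z.1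
    calc energyDensity m p ν b η z.1 (u z.1 z.2) (G z.1 z.2)
        ≤ 1 * (fluxWeight m p (u z.1 z.2) * ‖G z.1 z.2‖ ^ p) * (ν ^ μ) ^ (-b - 1) := by
          unfold energyDensity
          gcongr
          exact hη1 _
      _ = (ν ^ μ) ^ (-b - 1) / K₁ * (K₁ * (fluxWeight m p (u z.1 z.2) * ‖G z.1 z.2‖ ^ p)) := by
          field_simp
      _ ≤ _ := by gcongr
  refine ⟨hPi, ?_⟩
  -- the right-hand side of the energy estimate
  have hB : ∀ t ∈ Icc t₁ t₂, ∫ x in E, profilePrimitive μ (ν ^ μ) b (u x t) * η x ≤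
      4 * V * M ^ (1 - b * μ) := by
    intro t ht
    have ht' : t ∈ Ioo 0 T := Icc_subset_Ioo h1 h2 ht
    obtain ⟨i1, i2⟩ := hu.integral_moment_le hm hEc hEΩ hη.continuous hη0 hη1 hV hVE hν hM hM0 ht'
      (hX t ht) (1 - b * μ)
    have i3 := hu.integrableOn_comp_mul hm hEc hEΩ (profilePrimitive_continuous hμ hε)
      (abs_profilePrimitive_sub_le (b := b) hμ hε hb.le) hη.continuous hη0 hη1 ht'
    have i4 : ∫ x in E, profilePrimitive μ (ν ^ μ) b (u x t) * η x ≤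
        ∫ x in E, 2 * (M ^ (1 - b * μ) + M ^ (1 - b * μ - 1) * ((u x t + ν) * η x)) := by
      refine setIntegral_mono_on i3 (i1.const_mul 2) hEm fun x hx => ?_
      have e0 : 0 ≤ u x t := hu.nonneg x (hEΩ hx) t ht'
      have e4 := hη0 x
      have e1 := profilePrimitive_le hμ hε hb (by linarith : b * μ < 1) e0
      have e2 : η x ≤ η x ^ (1 - b * μ) := by
        rcases e4.eq_or_lt with h | h
        · rw [← h, Real.zero_rpow (by linarith)]
        · calc η x = η x ^ (1 : ℝ) := (Real.rpow_one _).symm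
            _ ≤ _ := Real.rpow_le_rpow_of_exponent_ge h (hη1 x) (by linarith)
      have e3 : u x t ^ (1 - b * μ) / (1 - b * μ) ≤ 2 * (u x t + ν) ^ (1 - b * μ) := by
        rw [div_le_iff₀ (by linarith)]
        have : u x t ^ (1 - b * μ) ≤ (u x t + ν) ^ (1 - b * μ) := by
          gcongr
          · linarith
          · linarith
        have h0 : 0 ≤ (u x t + ν) ^ (1 - b * μ) := by positivity
        nlinarith
      calc profilePrimitive μ (ν ^ μ) b (u x t) * η x
          ≤ 2 * (u x t + ν) ^ (1 - b * μ) * η x ^ (1 - b * μ) := by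
            have := e1.trans e3
            gcongr
        _ = 2 * ((u x t + ν) * η x) ^ (1 - b * μ) := by
            rw [Real.mul_rpow (by positivity) e4]; ring
        _ ≤ _ := by
            gcongr
            exact rpow_le_rpow_add_mul (by positivity) hM0 (by linarith) (by linarith)
    rw [integral_const_mul] at i4
    linarith
  have hen := hu.neg_integral_flux_testGradient_le hm hp hK₂ hA hA' hR hsub hε hb hη hη0 hη1 hηs
    h1 h12 h2 hB
  set c := (m - μ) * (p - 1) + μ * (p - 1 - b) with hc
  have hceq : c = m * (p - 1) - b * μ := by rw [hc]; ring
  have hc0 : 0 ≤ c := by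
    have := mul_nonneg (sub_nonneg.2 hμm) (sub_nonneg.2 hp.le)
    have := mul_nonneg hμ.le (sub_nonneg.2 hbp)
    rw [hc]; linarith
  obtain ⟨i5, i6⟩ := hu.setIntegral_moment_le hm hEc hEΩ hη.continuous hη0 hη1 hV hVE hν hM hM0
    h1 h12 h2 hX c
  -- Half of the coercive constant `b K₁`: Young's inequality spends this half on the term with
  -- `Dη`, and the other half remains on the left.
  set θ := b * K₁ / 2 with hθ
  have hθ0 : 0 < θ := by positivity
  set D := (K₂ * C) ^ p * θ ^ (1 - p) * 2 ^ (p - 1 - b) with hD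
  have hD0 : 0 < D := by positivity
  have hpt : ∀ᵐ z ∂(volume.restrict S), θ * energyDensity m p ν b η z.1 (u z.1 z.2) (G z.1 z.2) -
      D * (1 / r ^ p) * (M ^ c + M ^ (c - 1) * ((u z.1 z.2 + ν) * η z.1)) ≤
      -inner ℝ (flux A m z.1 z.2 (u z.1 z.2) (G z.1 z.2))
        (testGradient μ (ν ^ μ) b η z.1 (u z.1 z.2) (G z.1 z.2)) := by
    filter_upwards [hbds, ae_restrict_mem hSm] with z hz hzS
    have huz := hu0 z hzS
    obtain ⟨e1, e2⟩ := hz (u z.1 z.2) (G z.1 z.2)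
    set F := flux A m z.1 z.2 (u z.1 z.2) (G z.1 z.2) with hFdef
    set κ := fluxWeight m p (u z.1 z.2) with hκ
    have hκ0 : 0 ≤ κ := fluxWeight_nonneg m p _
    have hκd : κ ≤ (u z.1 z.2 + ν) ^ ((m - μ) * (p - 1)) :=
      fluxWeight_le hp (by positivity) (by linarith)
    have hY := density_le (b := b) (e := -b) (q := p - 1 - b) (c := c) hp
      (by positivity : 0 ≤ K₂ * C) hθ0 (norm_nonneg (G z.1 z.2)) huz hν hμ hκ0 hκd (hη0 z.1)
      (hη1 z.1) hδ hr hM0 (by ring) (by linarith) hc hc0 (by linarith) (by linarith)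
    set W := u z.1 z.2 ^ μ + ν ^ μ with hW
    have hW0 : 0 < W := by positivity
    have e3 : testGradient μ (ν ^ μ) b η z.1 (u z.1 z.2) (G z.1 z.2) =
        W ^ (-b) • gradient η z.1 + (η z.1 * (-b * W ^ (-b - 1))) • G z.1 z.2 := by
      rw [testGradient, profile, max_eq_left huz]
    have e4 : energyDensity m p ν b η z.1 (u z.1 z.2) (G z.1 z.2) =
        η z.1 * (κ * ‖G z.1 z.2‖ ^ p) * W ^ (-b - 1) := rfl
    have e5 : inner ℝ F (gradient η z.1) ≤
        K₂ * (κ * ‖G z.1 z.2‖ ^ (p - 1)) * (C * (η z.1 ^ (1 - δ) / r)) := by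
      refine (real_inner_le_norm _ _).trans ?_
      exact mul_le_mul e1 (hηg z.1) (norm_nonneg _) ((norm_nonneg _).trans e1)
    rw [e3, e4, inner_add_right, inner_smul_right, inner_smul_right]
    have e6 : W ^ (-b) * inner ℝ F (gradient η z.1) ≤
        K₂ * C * (κ * ‖G z.1 z.2‖ ^ (p - 1)) * W ^ (-b) * (η z.1 ^ (1 - δ) / r) := by
      calc _ ≤ W ^ (-b) * (K₂ * (κ * ‖G z.1 z.2‖ ^ (p - 1)) * (C * (η z.1 ^ (1 - δ) / r))) := by
            gcongr
        _ = _ := by ring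
    have e7 : b * (η z.1 * W ^ (-b - 1)) * (K₁ * (κ * ‖G z.1 z.2‖ ^ p)) ≤
        b * (η z.1 * W ^ (-b - 1)) * inner ℝ F (G z.1 z.2) := by
      have := hη0 z.1
      gcongr
    have e8 : b * (η z.1 * W ^ (-b - 1)) * (K₁ * (κ * ‖G z.1 z.2‖ ^ p)) =
        2 * (θ * (η z.1 * (κ * ‖G z.1 z.2‖ ^ p) * W ^ (-b - 1))) := by
      rw [hθ]; ring
    have e9 : D * (1 / r ^ p) = (K₂ * C) ^ p * θ ^ (1 - p) * 2 ^ (p - 1 - b) * (1 / r ^ p) := rfl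
    rw [e9]
    linarith
  have hint := integral_mono_ae ((hPi.const_mul θ).sub (i5.const_mul (D * (1 / r ^ p)))) hFΨ.neg hpt
  simp only [Pi.sub_apply, Pi.neg_apply] at hint
  rw [integral_neg, integral_sub (hPi.const_mul θ) (i5.const_mul (D * (1 / r ^ p))),
    integral_const_mul, integral_const_mul] at hint
  -- The time factor is worth `ν^{1-λ} ≤ M^{1-λ}`, which raises `M^{λ-bμ}` to the power `M^{1-bμ}`
  -- produced by the primitive.
  have hfin : D * (1 / r ^ p) * (∫ z in S, (M ^ c + M ^ (c - 1) * ((u z.1 z.2 + ν) * η z.1))) ≤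
      2 * D * V * M ^ (1 - b * μ) := by
    have e1 : ν ^ (1 - m * (p - 1)) ≤ M ^ (1 - m * (p - 1)) := by
      gcongr
    have e2 : M ^ (1 - m * (p - 1)) * M ^ c = M ^ (1 - b * μ) := by
      rw [← Real.rpow_add hM0, hceq]; ring_nf
    calc _ ≤ D * (1 / r ^ p) * (2 * V * (t₂ - t₁) * M ^ c) := by gcongr
      _ = 2 * D * V * (((t₂ - t₁) / r ^ p) * M ^ c) := by ring
      _ ≤ 2 * D * V * (M ^ (1 - m * (p - 1)) * M ^ c) := by
          have := hH.trans e1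
          gcongr
      _ = _ := by rw [e2]
  rw [div_mul_eq_mul_div, div_mul_eq_mul_div, le_div_iff₀ hθ0]
  linarith

end solution

/-! ### The `L¹` Harnack estimate -/

section solution
variable {Ω : Set (Space N)} {T m p : ℝ} {A : Space N → ℝ → ℝ → Space N → Space N}
  {u : Space N → ℝ → ℝ} {G : Space N → ℝ → Space N}

/-- Two weighted spatial integrals of the solution differ by an integral of the flux. -/
lemma IsLocalWeakSolutionWith.abs_integral_mul_sub_le
    (hu : IsLocalWeakSolutionWith Ω T m p A u G) {y : Space N} {R : ℝ}
    (hEΩ : closedBall y R ⊆ Ω) {η : Space N → ℝ} (hη : ContDiff ℝ ∞ η) (hη0 : ∀ x, 0 ≤ η x)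
    (hη1 : ∀ x, η x ≤ 1) (hηs : tsupport η ⊆ ball y R) {t₁ t₂ τ τ' : ℝ} (h1 : 0 < t₁)
    (h2 : t₂ < T) (hτ : t₁ ≤ τ) (hττ' : τ < τ') (hτ' : τ' ≤ t₂) {f : Space N × ℝ → ℝ}
    (hf : IntegrableOn f (closedBall y R ×ˢ Ioo t₁ t₂))
    (hFf : ∀ᵐ z ∂(volume.restrict (closedBall y R ×ˢ Ioo t₁ t₂)),
      ‖flux A m z.1 z.2 (u z.1 z.2) (G z.1 z.2)‖ * ‖gradient η z.1‖ ≤ f z) :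
    |(∫ x in closedBall y R, u x τ' * η x) - ∫ x in closedBall y R, u x τ * η x| ≤
      ∫ z in closedBall y R ×ˢ Ioo t₁ t₂, f z := by
  set E := closedBall y R with hE
  have hEc : IsCompact E := isCompact_closedBall y R
  have hEm : MeasurableSet E := hEc.measurableSet
  have hEf : IsFiniteMeasure (volume.restrict E) := isFiniteMeasure_restrict.2 hEc.measure_lt_top.ne
  have hηc : HasCompactSupport η := (isCompact_closedBall y R).of_isClosed_subset
    (isClosed_tsupport _) (hηs.trans ball_subset_closedBall)
  obtain ⟨C, hC⟩ := exists_bound_gradient hη hηc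
  have hD : MemLp (gradient η) (ENNReal.ofReal p) (volume.restrict E) :=
    MemLp.of_bound (continuous_gradient hη).aestronglyMeasurable C (Eventually.of_forall hC)
  rw [hu.integral_sub_eq hEc hEΩ (h1.trans_le hτ) hττ' (hτ'.trans_lt h2) hη0
    hη.continuous.aestronglyMeasurable hη1 hD
    (memW0_of_contDiff hη hηc (hηs.trans ball_subset_interior_closedBall)), abs_neg]
  have hsub : E ×ˢ Ioo τ τ' ⊆ E ×ˢ Ioo t₁ t₂ := Set.prod_mono le_rfl (Ioo_subset_Ioo hτ hτ')
  have hle : volume.restrict (E ×ˢ Ioo τ τ') ≤ volume.restrict (E ×ˢ Ioo t₁ t₂) :=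
    Measure.restrict_mono hsub le_rfl
  have h3 : |∫ z in E ×ˢ Ioo τ τ',
      inner ℝ (flux A m z.1 z.2 (u z.1 z.2) (G z.1 z.2)) (gradient η z.1)| ≤
      ∫ z in E ×ˢ Ioo τ τ', f z := by
    rw [← Real.norm_eq_abs]
    refine norm_integral_le_of_norm_le (hf.mono_set hsub) ?_
    filter_upwards [ae_mono hle hFf] with z hz
    exact (norm_inner_le_norm _ _).trans hz
  refine h3.trans (setIntegral_mono_set hf ?_ hsub.eventuallyLE)
  filter_upwards [hFf] with z hz
  exact (mul_nonneg (norm_nonneg _) (norm_nonneg _)).trans hz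

end solution

/-- The `L¹` Harnack estimate between two times of a compact subinterval, for integrals over
balls and with the intrinsic scale `ν` as additive error. -/
lemma exists_integral_le (N : ℕ) {m p K₁ K₂ : ℝ} (hm : 0 < m) (hp : 1 < p)
    (hK₁ : 0 < K₁) (hK₂ : 0 < K₂) (hlam : m * (p - 1) < 1) :
    ∃ C₀ : ℝ, 0 < C₀ ∧ ∀ (Ω : Set (Space N)) (T : ℝ) (A : Space N → ℝ → ℝ → Space N → Space N)
      (u : Space N → ℝ → ℝ), IsCaratheodory Ω T A → StructureConditions Ω T m p K₁ K₂ A →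
      IsLocalWeakSolution Ω T m p A u → ∀ (y : Space N) (r t₁ t₂ ν : ℝ), 0 < r → 0 < ν →
      ball y (2 * r) ⊆ Ω → 0 < t₁ → t₁ < t₂ → t₂ < T →
      (t₂ - t₁) / r ^ p ≤ ν ^ (1 - m * (p - 1)) → ∀ τ ∈ Icc t₁ t₂, ∀ τ' ∈ Icc t₁ t₂,
      ∫ x in ball y r, u x τ ≤
        2 * (∫ x in closedBall y (7 / 4 * r), u x τ') + C₀ * volume.real (ball y (2 * r)) * ν := by
  set μ := mMinus m with hμdef
  have hμ : 0 < μ := mMinus_pos hm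
  have hμ1 : μ ≤ 1 := mMinus_le_one m
  have hμm : μ ≤ m := mMinus_le m
  set lam := m * (p - 1) with hlamdef
  have hlam0 : 0 < lam := mul_pos hm (by linarith)
  -- The bound by `p - 1` keeps the exponents of the energy estimate nonnegative, `1/2` controls
  -- `1/(1 - bμ)`, and the last bound keeps the moment order `λ + bμ(p-1)` in the lower half of `[λ,
  -- 1]`.
  obtain ⟨b, hb, hbp, hb1, hbl⟩ : ∃ b : ℝ, 0 < b ∧ b ≤ p - 1 ∧ b ≤ 1 / 2 ∧
      b * (p - 1) ≤ (1 - lam) / 2 := by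
    have hp0 : 0 < p - 1 := by linarith
    have hl0 : 0 < 1 - lam := by linarith
    refine ⟨min (p - 1) (min (1 / 2) ((1 - lam) / 2 / (p - 1))), by positivity,
      min_le_left _ _, (min_le_right _ _).trans (min_le_left _ _), ?_⟩
    rw [← le_div_iff₀ hp0]
    exact (min_le_right _ _).trans (min_le_right _ _)
  -- The gradient loss `δ = 1/k` of the cutoff must fit into the other half: `δ p ≤ (1 - λ)/2`.
  obtain ⟨k, hk⟩ := exists_nat_gt (max 1 (2 * p / (1 - lam)))
  have hk1 : (1 : ℝ) < k := (le_max_left _ _).trans_lt hk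
  have hk2 : 2 * p / (1 - lam) < k := (le_max_right _ _).trans_lt hk
  have hk0 : 0 < k := by exact_mod_cast zero_lt_one.trans hk1
  set δ : ℝ := 1 / (k : ℝ) with hδdef
  have hδ : δ < 1 := by rw [hδdef, div_lt_one (by linarith)]; exact hk1
  have hδp : δ * p ≤ (1 - lam) / 2 := by
    rw [div_lt_iff₀ (by linarith)] at hk2
    rw [hδdef, one_div, inv_mul_eq_div, div_le_iff₀ (by linarith)]
    linarith
  obtain ⟨C, hC, hcut⟩ := exists_cutoff N k hk0
  set a := b * μ with ha
  have ha0 : 0 < a := by positivity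
  set C₁ := (4 + 2 * ((K₂ * C) ^ p * (b * K₁ / 2) ^ (1 - p) * 2 ^ (p - 1 - b))) / (b * K₁ / 2)
    with hC₁
  have hC₁0 : 0 < C₁ := by positivity
  -- Makes the energy part of the flux integral exactly a quarter of `V M`.
  set θ₀ := 1 / (4 * C₁) with hθ₀
  have hθ₀0 : 0 < θ₀ := by positivity
  set q := p * (0 + b + 1) - b - 1 with hq
  have hq0 : 0 ≤ q := by
    have : 0 ≤ (b + 1) * (p - 1) := mul_nonneg (by linarith) (by linarith)
    rw [hq]; linarith
  set C₂ := 2 * ((K₂ * C) ^ p * θ₀ ^ (1 - p) * 2 ^ q) with hC₂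
  have hC₂0 : 0 < C₂ := by positivity
  -- the threshold below which the error term can be absorbed
  set k₀ := (1 / (4 * C₂)) ^ (1 / (1 - lam)) with hk₀
  have hk₀0 : 0 < k₀ := by positivity
  have hk₀' : C₂ * k₀ ^ (1 - lam) = 1 / 4 := by
    rw [hk₀, ← Real.rpow_mul (by positivity), one_div_mul_cancel (by linarith), Real.rpow_one]
    field_simp
  refine ⟨1 + 1 / k₀, by positivity, ?_⟩
  rintro Ω T A u hA hA' ⟨G, hu⟩ y r t₁ t₂ ν hr hν hball h1 h12 h2 hH τ hτ τ' hτ'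
  obtain ⟨η, hη, hη0, hη1, hηr, hηs, hηg⟩ := hcut y r hr
  -- The radii `3/2 < 7/4 < 15/8 < 2` leave room for the cutoff's support, for mollification, and
  -- for a compact ball inside `B_{2r}`.
  set R := 7 / 4 * r with hR
  set E := closedBall y R with hE
  have hsub : closedBall y (15 / 8 * r) ⊆ Ω :=
    (closedBall_subset_ball (by linarith)).trans hball
  have hRR' : R < 15 / 8 * r := by rw [hR]; linarith
  have hEΩ : E ⊆ Ω := (closedBall_subset_closedBall hRR'.le).trans hsub
  have hEc : IsCompact E := isCompact_closedBall y R
  have hEm : MeasurableSet E := hEc.measurableSet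
  have hηs' : tsupport η ⊆ ball y R :=
    hηs.trans (closedBall_subset_ball (by rw [hR]; linarith))
  set V := volume.real (ball y (2 * r)) with hV
  have hV0 : 0 < V := ENNReal.toReal_pos (measure_ball_pos _ _ (by linarith)).ne'
    measure_ball_lt_top.ne
  have hVE : volume.real E ≤ V :=
    measureReal_mono (closedBall_subset_ball (by rw [hR]; linarith)) measure_ball_lt_top.ne
  have hIcc : Icc t₁ t₂ ⊆ Ioo 0 T := Icc_subset_Ioo h1 h2
  -- the supremum of the weighted integrals is attained
  have hcont : ContinuousOn (fun t => ∫ x in E, u x t * η x) (Icc t₁ t₂) :=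
    (hu.continuousOn_integral_comp_mul hm hEc hEΩ (g := fun v => v) (L := 1) zero_le_one
      continuous_id (by simp) hη.continuous hη0 hη1).mono hIcc
  obtain ⟨s, hs, hmax⟩ := isCompact_Icc.exists_isMaxOn (nonempty_Icc.2 h12.le) hcont
  set X := ∫ x in E, u x s * η x with hXdef
  have hX : ∀ t ∈ Icc t₁ t₂, ∫ x in E, u x t * η x ≤ X := fun t ht => hmax ht
  have hint_nonneg : ∀ t ∈ Icc t₁ t₂, 0 ≤ ∫ x in E, u x t * η x := fun t ht =>
    setIntegral_nonneg hEm fun x hx => mul_nonneg (hu.nonneg x (hEΩ hx) t (hIcc ht)) (hη0 x)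
  have hX0 : 0 ≤ X := hint_nonneg s hs
  have hui : ∀ t ∈ Icc t₁ t₂, IntegrableOn (fun x => u x t) E := fun t ht =>
    hu.integrableOn_slice hm hEc hEΩ (hIcc ht)
  have huηi : ∀ t ∈ Icc t₁ t₂, IntegrableOn (fun x => u x t * η x) E := fun t ht =>
    hu.integrableOn_comp_mul hm hEc hEΩ (g := fun v => v) (L := 1) continuous_id (by simp)
      hη.continuous hη0 hη1 (hIcc ht)
  have hlow : ∫ x in ball y r, u x τ ≤ X := by
    have e1 : ∫ x in ball y r, u x τ = ∫ x in ball y r, u x τ * η x := by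
      refine setIntegral_congr_fun measurableSet_ball fun x hx => ?_
      simp only [hηr x hx, mul_one]
    rw [e1]
    refine le_trans ?_ (hX τ hτ)
    refine setIntegral_mono_set (huηi τ hτ) ?_
      (ball_subset_closedBall.trans (closedBall_subset_closedBall (by rw [hR]; linarith))).eventuallyLE
    filter_upwards [ae_restrict_mem hEm] with x hx
    exact mul_nonneg (hu.nonneg x (hEΩ hx) τ (hIcc hτ)) (hη0 x)
  have hup : ∫ x in E, u x τ' * η x ≤ ∫ x in E, u x τ' := by
    refine setIntegral_mono_on (huηi τ' hτ') (hui τ' hτ') hEm fun x hx => ?_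
    exact mul_le_of_le_one_right (hu.nonneg x (hEΩ hx) τ' (hIcc hτ')) (hη1 x)
  have hI0 : 0 ≤ ∫ x in E, u x τ' := (hint_nonneg τ' hτ').trans hup
  set M := X / V + ν with hM
  have hXM : X ≤ V * M := by
    have : V * M = X + V * ν := by rw [hM]; field_simp
    rw [this]; linarith [mul_pos hV0 hν]
  have hM0 : 0 < M := by positivity
  refine hlow.trans ?_
  -- In the first case `M` is at most a multiple of `ν`, and the additive error alone covers `X`.
  rcases lt_or_ge (k₀ * M) ν with hcase | hcase
  · have e1 : M ≤ ν / k₀ := by rw [le_div_iff₀ hk₀0]; linarith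
    calc X ≤ V * M := hXM
      _ ≤ V * (ν / k₀) := by gcongr
      _ = 1 / k₀ * V * ν := by ring
      _ ≤ 2 * (∫ x in E, u x τ') + (1 + 1 / k₀) * V * ν := by
          have : 0 < V * ν := by positivity
          linarith
  -- the energy estimate, and absorption of the flux
  obtain ⟨hPi, hP⟩ := hu.integral_energyDensity_le hm hp hK₁ hK₂ hA hA' hRR' hsub hν hb hbp hb1 hδ
    (by linarith) hlam hr hC hη hη0 hη1 hηs' hηg h1 h12 h2 hV0 hVE hM hX0 hX hH
  set c := (m - μ) * (p - 1) + μ * q with hc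
  have hceq : c = lam + a * (p - 1) := by rw [hc, hq, hlamdef, ha]; ring
  have hap : a * (p - 1) ≤ (1 - lam) / 2 := by
    have : a ≤ b := mul_le_of_le_one_right hb.le hμ1
    have : a * (p - 1) ≤ b * (p - 1) := mul_le_mul_of_nonneg_right this (by linarith)
    linarith
  have hap0 : 0 < a * (p - 1) := mul_pos ha0 (by linarith)
  obtain ⟨i1, i2⟩ := hu.setIntegral_moment_le hm hEc hEΩ hη.continuous hη0 hη1 hV0 hVE hν hM hM0
    h1 h12 h2 hX c
  -- The power `M^a` compensates the energy bound `M^{1-a}`. Its cost `M^{a(1-p)}` in the other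
  -- Young term cancels the excess `a(p-1)` of `c` over `λ`.
  set θ := θ₀ * M ^ a with hθ
  have hθ0 : 0 < θ := by positivity
  set D := (K₂ * C) ^ p * θ ^ (1 - p) * 2 ^ q * (1 / r ^ p) with hD
  have hD0 : 0 < D := by positivity
  have hfi := (hPi.const_mul θ).add (i1.const_mul D)
  have hFf : ∀ᵐ z ∂(volume.restrict (E ×ˢ Ioo t₁ t₂)),
      ‖flux A m z.1 z.2 (u z.1 z.2) (G z.1 z.2)‖ * ‖gradient η z.1‖ ≤
      θ * energyDensity m p ν b η z.1 (u z.1 z.2) (G z.1 z.2) +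
        D * (M ^ c + M ^ (c - 1) * ((u z.1 z.2 + ν) * η z.1)) := by
    have hSΩ : E ×ˢ Ioo t₁ t₂ ⊆ spaceTime Ω T :=
      Set.prod_mono hEΩ (Ioo_subset_Ioo h1.le h2.le)
    filter_upwards [ae_mono (Measure.restrict_mono hSΩ le_rfl) (flux_bounds hm hA'),
      ae_restrict_mem (hEm.prod measurableSet_Ioo)] with z hz hzS
    have huz : 0 ≤ u z.1 z.2 := hu.nonneg _ (hSΩ hzS).1 _ (hSΩ hzS).2
    have hκd : fluxWeight m p (u z.1 z.2) ≤ (u z.1 z.2 + ν) ^ ((m - μ) * (p - 1)) :=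
      fluxWeight_le hp (by positivity) (by linarith)
    have hY := density_le (b := b) (e := 0) (q := q) (c := c) hp
      (by positivity : 0 ≤ K₂ * C) hθ0 (norm_nonneg (G z.1 z.2)) huz hν hμ
      (fluxWeight_nonneg m p _) hκd (hη0 z.1)
      (hη1 z.1) hδ hr hM0 hq hq0 hc (by linarith) (by linarith) (by linarith)
    rw [Real.rpow_zero, mul_one] at hY
    have e1 := (hz (u z.1 z.2) (G z.1 z.2)).1
    calc _ ≤ K₂ * (fluxWeight m p (u z.1 z.2) * ‖G z.1 z.2‖ ^ (p - 1)) *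
          (C * (η z.1 ^ (1 - δ) / r)) :=
          mul_le_mul e1 (hηg z.1) (norm_nonneg _) ((norm_nonneg _).trans e1)
      _ = K₂ * C * (fluxWeight m p (u z.1 z.2) * ‖G z.1 z.2‖ ^ (p - 1)) *
          (η z.1 ^ (1 - δ) / r) := by ring
      _ ≤ _ := hY
  have hflux : ∫ z in E ×ˢ Ioo t₁ t₂,
      (θ * energyDensity m p ν b η z.1 (u z.1 z.2) (G z.1 z.2) +
        D * (M ^ c + M ^ (c - 1) * ((u z.1 z.2 + ν) * η z.1))) ≤ V * M / 2 := by
    rw [integral_add (hPi.const_mul θ) (i1.const_mul D), integral_const_mul, integral_const_mul]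
    have e1 : θ * (∫ z in E ×ˢ Ioo t₁ t₂, energyDensity m p ν b η z.1 (u z.1 z.2) (G z.1 z.2)) ≤
        V * M / 4 := by
      have e2 : M ^ a * M ^ (1 - a) = M := by
        rw [← Real.rpow_add hM0]; simp
      calc _ ≤ θ * (C₁ * V * M ^ (1 - a)) := by gcongr
        _ = (θ₀ * C₁) * V * (M ^ a * M ^ (1 - a)) := by rw [hθ]; ring
        _ = V * M / 4 := by
            rw [e2, hθ₀]; field_simp
    have e3 : D * (∫ z in E ×ˢ Ioo t₁ t₂,
        (M ^ c + M ^ (c - 1) * ((u z.1 z.2 + ν) * η z.1))) ≤ V * M / 4 := by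
      have e4 : ν ^ (1 - lam) ≤ k₀ ^ (1 - lam) * M ^ (1 - lam) := by
        rw [← Real.mul_rpow hk₀0.le hM0.le]
        exact Real.rpow_le_rpow hν.le hcase (by linarith)
      have e5 : θ ^ (1 - p) = θ₀ ^ (1 - p) * M ^ (a * (1 - p)) := by
        rw [hθ, Real.mul_rpow hθ₀0.le (by positivity), ← Real.rpow_mul hM0.le]
      have e6 : M ^ (1 - lam) * (M ^ (a * (1 - p)) * M ^ c) = M := by
        rw [← Real.rpow_add hM0, ← Real.rpow_add hM0, hceq,
          show 1 - lam + (a * (1 - p) + (lam + a * (p - 1))) = 1 by ring, Real.rpow_one]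
      calc _ ≤ D * (2 * V * (t₂ - t₁) * M ^ c) := by gcongr
        _ = C₂ * V * (((t₂ - t₁) / r ^ p) * (M ^ (a * (1 - p)) * M ^ c)) := by
            rw [hD, hC₂, e5]; ring
        _ ≤ C₂ * V * (k₀ ^ (1 - lam) * M ^ (1 - lam) * (M ^ (a * (1 - p)) * M ^ c)) := by
            have := hH.trans e4
            gcongr
        _ = C₂ * k₀ ^ (1 - lam) * V * (M ^ (1 - lam) * (M ^ (a * (1 - p)) * M ^ c)) := by ring
        _ = V * M / 4 := by rw [e6, hk₀']; ring
    linarith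
  have hdiff : ∀ t ∈ Icc t₁ t₂, ∀ t' ∈ Icc t₁ t₂,
      (∫ x in E, u x t * η x) ≤ (∫ x in E, u x t' * η x) + V * M / 2 := by
    intro t ht t' ht'
    rcases lt_trichotomy t t' with h | h | h
    · have := hu.abs_integral_mul_sub_le hEΩ hη hη0 hη1 hηs' h1 h2 ht.1 h ht'.2
        hfi hFf
      have := (abs_le.1 (this.trans hflux)).1
      linarith
    · rw [h]; linarith [mul_pos hV0 hM0]
    · have := hu.abs_integral_mul_sub_le hEΩ hη hη0 hη1 hηs' h1 h2 ht'.1 h ht.2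
        hfi hFf
      have := (abs_le.1 (this.trans hflux)).2
      linarith
  -- Comparing with the maximising time `s` gives `X ≤ ∫ u(·,τ') η + (X + Vν)/2`; `X` is finite, so
  -- half of it moves to the left.
  have h3 := hdiff s hs τ' hτ'
  have h4 : V * M = X + V * ν := by rw [hM]; field_simp
  have h5 : 0 < 1 / k₀ * V * ν := by positivity
  rw [h4] at h3
  linarith

/-! ### Averages with values in `[0, ∞]` and the conclusion -/

/-- The two balls differ in volume by the factor `2^N`, which enters both constants; the volume in
the additive error cancels. -/
lemma div_volume_ball_le {N : ℕ} {y : Space N} {r C₀ ν : ℝ} (hr : 0 < r) (hC₀ : 0 ≤ C₀)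
    {I J : ℝ≥0∞}
    (h : I ≤ 2 * J + ENNReal.ofReal (C₀ * volume.real (ball y (2 * r)) * ν)) :
    I / volume (ball y r) ≤ ENNReal.ofReal (2 ^ N * (2 + C₀)) * (J / volume (ball y (2 * r))) +
      ENNReal.ofReal (2 ^ N * (2 + C₀) * ν) := by
  set c : ℝ≥0∞ := ENNReal.ofReal (2 ^ N) with hc
  have hc0 : c ≠ 0 := by simp [hc]
  have hct : c ≠ ⊤ := ENNReal.ofReal_ne_top
  have hvol : volume (ball y (2 * r)) = c * volume (ball y r) := by
    rw [Measure.addHaar_ball_mul_of_pos volume y (by norm_num : (0 : ℝ) < 2) r,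
      Measure.addHaar_ball_center volume y r, finrank_euclideanSpace, Fintype.card_fin]
  set v := volume (ball y (2 * r)) with hv
  have hv0 : v ≠ 0 := (measure_ball_pos volume y (by linarith)).ne'
  have hvt : v ≠ ⊤ := measure_ball_lt_top.ne
  have hV : ENNReal.ofReal (volume.real (ball y (2 * r))) = v := ENNReal.ofReal_toReal hvt
  have hV0 : 0 ≤ volume.real (ball y (2 * r)) := measureReal_nonneg
  have e1 : I / volume (ball y r) = c * I / v := by
    rw [hvol, ENNReal.mul_div_mul_left _ _ hc0 hct]
  have e2 : ENNReal.ofReal (C₀ * volume.real (ball y (2 * r)) * ν) = ENNReal.ofReal (C₀ * ν) * v := by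
    rw [← hV, mul_right_comm, ENNReal.ofReal_mul' hV0]
  have e3 : c * 2 ≤ ENNReal.ofReal (2 ^ N * (2 + C₀)) := by
    rw [hc, show (2 : ℝ≥0∞) = ENNReal.ofReal 2 by simp, ← ENNReal.ofReal_mul (by positivity)]
    apply ENNReal.ofReal_le_ofReal
    gcongr
    linarith
  have e4 : c * ENNReal.ofReal (C₀ * ν) ≤ ENNReal.ofReal (2 ^ N * (2 + C₀) * ν) := by
    rw [hc, ← ENNReal.ofReal_mul (by positivity)]
    rcases le_or_gt 0 ν with h0 | h0
    · apply ENNReal.ofReal_le_ofReal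
      have : (0 : ℝ) ≤ 2 ^ N * ν := by positivity
      nlinarith
    · rw [ENNReal.ofReal_of_nonpos]
      · simp
      · exact mul_nonpos_of_nonneg_of_nonpos (by positivity)
          (mul_nonpos_of_nonneg_of_nonpos hC₀ h0.le)
  rw [e1]
  calc c * I / v ≤ c * (2 * J + ENNReal.ofReal (C₀ * ν) * v) / v := by rw [← e2]; gcongr
    _ = c * 2 * (J / v) + c * ENNReal.ofReal (C₀ * ν) * (v / v) := by
        rw [mul_add, ENNReal.add_div]
        simp only [div_eq_mul_inv]
        ring
    _ ≤ _ := by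
        rw [ENNReal.div_self hv0 hvt, mul_one]
        gcongr

end DoublyNonlinear
end

theorem theorem3p1 (N : ℕ) (hN : 1 ≤ N) (m p K₁ K₂ : ℝ) (hm : 0 < m) (hp : 1 < p)
    (hK₁ : 0 < K₁) (hK₂ : 0 < K₂) (hlam : m * (p - 1) < 1) :
    ∃ γ : ℝ, 0 < γ ∧
      ∀ (Ω : Set (DoublyNonlinear.Space N)) (T : ℝ)
        (A : DoublyNonlinear.Space N → ℝ → ℝ → DoublyNonlinear.Space N → DoublyNonlinear.Space N)
        (u : DoublyNonlinear.Space N → ℝ → ℝ),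
        IsOpen Ω → 0 < T →
        DoublyNonlinear.IsCaratheodory Ω T A →
        DoublyNonlinear.StructureConditions Ω T m p K₁ K₂ A →
        DoublyNonlinear.IsLocalWeakSolution Ω T m p A u →
        ∀ (y : DoublyNonlinear.Space N) (r s t : ℝ), 0 < r → s < t →
          DoublyNonlinear.cylinder (2 * r) (t - s) y t ⊆ DoublyNonlinear.spaceTime Ω T →
          (⨆ τ ∈ Icc s t ∩ Ioo 0 T, DoublyNonlinear.ballAverage y r (fun x => u x τ))
            ≤ ENNReal.ofReal γ *
                (⨅ τ ∈ Icc s t ∩ Ioo 0 T, DoublyNonlinear.ballAverage y (2 * r) (fun x => u x τ))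
              + ENNReal.ofReal (γ * ((t - s) / r ^ p) ^ (1 / (1 - m * (p - 1)))) := by
  obtain ⟨C₀, hC₀, hmain⟩ := DoublyNonlinear.exists_integral_le N hm hp hK₁ hK₂ hlam
  refine ⟨2 ^ N * (2 + C₀), by positivity, ?_⟩
  intro Ω T A u _ _ hA hA' hu y r s t hr hst hcyl
  set ν := ((t - s) / r ^ p) ^ (1 / (1 - m * (p - 1))) with hν
  have hts : 0 < t - s := by linarith
  have hν0 : 0 < ν := by positivity
  have hνpow : ν ^ (1 - m * (p - 1)) = (t - s) / r ^ p := by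
    rw [hν, ← Real.rpow_mul (by positivity), one_div_mul_cancel (by linarith), Real.rpow_one]
  -- Any time in `(s, t)` extracts the spatial inclusion from the cylinder; the midpoint serves.
  have hball : ball y (2 * r) ⊆ Ω := fun x hx =>
    (hcyl (show (x, (s + t) / 2) ∈ _ from ⟨hx, by constructor <;> simp only <;> linarith⟩)).1
  have key : ∀ τ ∈ Icc s t ∩ Ioo 0 T, ∀ τ' ∈ Icc s t ∩ Ioo 0 T,
      DoublyNonlinear.ballAverage y r (fun x => u x τ) ≤
        ENNReal.ofReal (2 ^ N * (2 + C₀)) *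
          DoublyNonlinear.ballAverage y (2 * r) (fun x => u x τ') +
        ENNReal.ofReal (2 ^ N * (2 + C₀) * ν) := by
    intro τ hτ τ' hτ'
    refine DoublyNonlinear.div_volume_ball_le hr hC₀.le ?_
    -- Equal times would give a degenerate interval, but then enlarging the ball suffices. Otherwise
    -- the interval spanned by `τ` and `τ'`, in either order, is compact in `(0, T)` and no longer
    -- than `t - s`.
    rcases eq_or_ne τ τ' with rfl | hne
    · calc ∫⁻ x in ball y r, ENNReal.ofReal (u x τ)
          ≤ ∫⁻ x in ball y (2 * r), ENNReal.ofReal (u x τ) :=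
            lintegral_mono_set (ball_subset_ball (by linarith))
        _ ≤ 2 * ∫⁻ x in ball y (2 * r), ENNReal.ofReal (u x τ) := 
            le_mul_of_one_le_left zero_le one_le_two
        _ ≤ _ := le_add_of_nonneg_right zero_le
    · have hlt : min τ τ' < max τ τ' := min_lt_max.2 hne
      have hH : (max τ τ' - min τ τ') / r ^ p ≤ ν ^ (1 - m * (p - 1)) := by
        rw [hνpow]
        gcongr
        · exact max_le hτ.1.2 hτ'.1.2
        · exact le_min hτ.1.1 hτ'.1.1
      have h1 := hmain Ω T A u hA hA' hu y r (min τ τ') (max τ τ') ν hr hν0 hball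
        (lt_min hτ.2.1 hτ'.2.1) hlt (max_lt hτ.2.2 hτ'.2.2) hH τ
        ⟨min_le_left _ _, le_max_left _ _⟩ τ' ⟨min_le_right _ _, le_max_right _ _⟩
      obtain ⟨G, hG⟩ := hu
      set E := closedBall y (7 / 4 * r) with hE
      have hE2 : E ⊆ ball y (2 * r) := closedBall_subset_ball (by linarith)
      have hrE : ball y r ⊆ E := ball_subset_closedBall.trans
        (closedBall_subset_closedBall (by linarith))
      have hEc : IsCompact E := isCompact_closedBall _ _
      have conv : ∀ σ ∈ Ioo 0 T, ∀ S ⊆ E, MeasurableSet S →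
          ∫⁻ x in S, ENNReal.ofReal (u x σ) = ENNReal.ofReal (∫ x in S, u x σ) := by
        intro σ hσ S hS hSm
        refine (ofReal_integral_eq_lintegral_ofReal
          ((hG.integrableOn_slice hm hEc (hE2.trans hball) hσ).mono_set hS) ?_).symm
        filter_upwards [ae_restrict_mem hSm] with x hx
        exact hG.nonneg x (hball (hE2 (hS hx))) σ hσ
      have hI0 : 0 ≤ ∫ x in E, u x τ' := setIntegral_nonneg hEc.measurableSet fun x hx =>
        hG.nonneg x (hball (hE2 hx)) τ' hτ'.2
      calc ∫⁻ x in ball y r, ENNReal.ofReal (u x τ)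
          = ENNReal.ofReal (∫ x in ball y r, u x τ) := conv τ hτ.2 _ hrE measurableSet_ball
        _ ≤ ENNReal.ofReal (2 * (∫ x in E, u x τ') +
              C₀ * volume.real (ball y (2 * r)) * ν) := ENNReal.ofReal_le_ofReal h1
        _ = 2 * (∫⁻ x in E, ENNReal.ofReal (u x τ')) +
              ENNReal.ofReal (C₀ * volume.real (ball y (2 * r)) * ν) := by
            rw [ENNReal.ofReal_add (by positivity) (by positivity), ENNReal.ofReal_mul (by norm_num),
              conv τ' hτ'.2 E le_rfl hEc.measurableSet, ENNReal.ofReal_ofNat]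
        _ ≤ _ := by
            gcongr
  refine iSup₂_le fun τ hτ => ?_
  -- The additive term and the finite nonzero constant are moved to the left, so that the infimum
  -- stands alone and can be tested at each `τ'`.
  rw [← tsub_le_iff_right]
  have hγ0 : ENNReal.ofReal (2 ^ N * (2 + C₀)) ≠ 0 := by
    rw [Ne, ENNReal.ofReal_eq_zero, not_le]; positivity
  rw [← ENNReal.div_le_iff' hγ0 ENNReal.ofReal_ne_top]
  refine le_iInf₂ fun τ' hτ' => ?_
  rw [ENNReal.div_le_iff' hγ0 ENNReal.ofReal_ne_top, tsub_le_iff_right]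
  exact key τ hτ τ' hτ'
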